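/- For $A,B,C\subset\mathbb{R}$ let $A(B+C)=\{a(b+c): a\in A,\ b\in B,\ c\in C\}$, and let $\dim_{\mathcal H}$ denote Hausdorff dimension. (i) If $A,B,C\subset\mathbb{R}$ are Borel sets with $$\dim_{\mathcal H}A+\dim_{\mathcal H}B+\dim_{\mathcal H}C>2,$$ then $A(B+C)$ has positive Lebesgue measure. (ii) The threshold $2$ is sharp: there exist non-empty compact sets $A,B,C\subset\mathbb{R}$ with $\dim_{\mathcal H}A+\dim_{\mathcal H}B+\dim_{\mathcal H}C=2$ for which $A(B+C)$ has Lebesgue measure zero. -/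

import Mathlib

open MeasureTheory
open scoped Pointwise

open Set Filter Topology
open scoped ENNReal NNReal

/-! Positivity. Frostman's lemma puts measures μA, μB, μC with exponents α + β + γ > 2 on compact
subsets of A ∖ {0}, B, C; μB is then multiplied by a Gaussian. Let ν be the law of a(b + c) under
their product. It is carried by a compact subset of A(B + C), so it suffices that its Fourier
transform is square integrable: such a measure does not charge null compacta
(`measure_eq_zero_of_lintegral_charFun_sq_lt_top`).

The transform of ν at ξ is the μA-average over a of the product of the transforms of μB and μC at
aξ. Cauchy-Schwarz in a separates the two factors, which are treated differently. The B factor is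
bounded for each ξ: the transform of the damped μB is essentially constant at scale one, the points
aξ put mass at most |ξ|^(-α) near any u, and the mean square of the transform up to |ξ| is
|ξ|^(1-β), giving |ξ|^(1-α-β). The C factor is bounded only on average over |ξ| ~ R, by R^(1-γ). A
dyadic shell thus contributes R^(2-α-β-γ), and these bounds are summable
(`lintegral_charFun_mulLaw_sq_lt_top`).

Frostman's lemma for Borel sets rests on dyadic content: it is continuous along increasing unions
and outer regular up to a factor 2, so Choquet's argument finds a compact subset of positive
content, on which mass is distributed down the binary tree.

Sharpness. Take A = {1} and B = C = E, where E consists of numbers whose binary digits are spread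
apart by zero blocks of density zero but unbounded length. Density zero keeps dim E = 1. Just before
a long block, E lies in very short intervals based at points of a lattice; lattices are closed under
addition, so E + E is equally thin, hence null. -/

namespace DyadicContent

/-! ### Dyadic content and capacitability -/

/-- The index `(k, i)` of the dyadic interval `[i / 2 ^ k, (i + 1) / 2 ^ k)` that contains `x`. -/
noncomputable def node (k : ℕ) (x : ℝ) : ℕ × ℤ := (k, ⌊(2 : ℝ) ^ k * x⌋)

/-- The dyadic interval with a given index. -/
def cell (p : ℕ × ℤ) : Set ℝ := {x | node p.1 x = p}

/-- A family of dyadic intervals covers a set. -/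
def Covers (S : Set (ℕ × ℤ)) (E : Set ℝ) : Prop := ∀ x ∈ E, ∃ k, node k x ∈ S

/-- The `s`-dimensional cost of families of dyadic intervals. -/
noncomputable def cost (s : ℝ) : Measure (ℕ × ℤ) :=
  Measure.count.withDensity fun p => ENNReal.ofReal ((2 : ℝ) ^ (-(p.1 * s)))

/-- The dyadic Hausdorff content. -/
noncomputable def content (s : ℝ) (E : Set ℝ) : ℝ≥0∞ :=
  ⨅ (S : Set (ℕ × ℤ)) (_ : Covers S E), cost s S

/-- The maximal elements of a family of dyadic intervals. -/
def maxl (S : Set (ℕ × ℤ)) : Set (ℕ × ℤ) :=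
  {p ∈ S | ∀ k < p.1, (k, p.2 / 2 ^ (p.1 - k)) ∉ S}

/-- Integer division by a power of two rounds down for negative indices as well, so it yields the
level-`k` ancestor. This matches the ancestor test in `maxl` with `node`. -/
lemma floor_div (k l : ℕ) (h : k ≤ l) (x : ℝ) :
    ⌊(2 : ℝ) ^ l * x⌋ / 2 ^ (l - k) = ⌊(2 : ℝ) ^ k * x⌋ := by
  have := Int.floor_div_natCast ((2 : ℝ) ^ l * x) (2 ^ (l - k))
  push_cast at this
  rw [← this]
  congr 1
  obtain ⟨m, rfl⟩ := Nat.exists_eq_add_of_le h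
  rw [Nat.add_sub_cancel_left, pow_add]
  field_simp

lemma cost_singleton (s : ℝ) (p : ℕ × ℤ) :
    cost s {p} = ENNReal.ofReal ((2 : ℝ) ^ (-(p.1 * s))) := by
  simp [cost, withDensity_apply]

lemma content_le {s : ℝ} {E : Set ℝ} {S : Set (ℕ × ℤ)} (h : Covers S E) :
    content s E ≤ cost s S := iInf₂_le S h

lemma content_mono (s : ℝ) {E F : Set ℝ} (h : E ⊆ F) : content s E ≤ content s F :=
  le_iInf₂ fun _ hS => content_le fun x hx => hS x (h hx)

lemma content_empty (s : ℝ) : content s ∅ = 0 := by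
  have : content s ∅ ≤ cost s ∅ := content_le (by simp [Covers])
  simpa using this

lemma content_union_le (s : ℝ) (E F : Set ℝ) :
    content s (E ∪ F) ≤ content s E + content s F := by
  refine ENNReal.le_of_forall_pos_le_add fun ε hε hfin => ?_
  have hε' : (ε / 2 : ℝ≥0∞) ≠ 0 := by simpa using hε.ne'
  have h1 : content s E < content s E + ε / 2 :=
    ENNReal.lt_add_right (ne_top_of_le_ne_top hfin.ne le_self_add) hε'
  have h2 : content s F < content s F + ε / 2 :=
    ENNReal.lt_add_right (ne_top_of_le_ne_top hfin.ne le_add_self) hε'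
  obtain ⟨S, hS, hS'⟩ := by simpa only [content, iInf_lt_iff] using h1
  obtain ⟨T, hT, hT'⟩ := by simpa only [content, iInf_lt_iff] using h2
  have hc : Covers (S ∪ T) (E ∪ F) := by
    rintro x (hx | hx)
    · exact (hS x hx).imp fun k hk => Or.inl hk
    · exact (hT x hx).imp fun k hk => Or.inr hk
  calc content s (E ∪ F) ≤ cost s (S ∪ T) := content_le hc
    _ ≤ cost s S + cost s T := measure_union_le _ _
    _ ≤ (content s E + ε / 2) + (content s F + ε / 2) := add_le_add hS'.le hT'.le
    _ = content s E + content s F + (ε / 2 + ε / 2) := by ring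
    _ = _ := by rw [ENNReal.add_halves]

lemma content_inter_cell_le (s : ℝ) (E : Set ℝ) (p : ℕ × ℤ) :
    content s (E ∩ cell p) ≤ ENNReal.ofReal ((2 : ℝ) ^ (-(p.1 * s))) := by
  rw [← cost_singleton]
  exact content_le fun x hx => ⟨p.1, hx.2⟩

/-- Levels are natural numbers, so among the members of `S` containing `x` there is a coarsest one,
and it is maximal. -/
lemma covers_maxl {S : Set (ℕ × ℤ)} {E : Set ℝ} (h : Covers S E) : Covers (maxl S) E := by
  classical
  intro x hx
  have hex := h x hx
  obtain ⟨m, hm, hmin⟩ : ∃ m, node m x ∈ S ∧ ∀ k < m, node k x ∉ S :=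
    ⟨Nat.find hex, Nat.find_spec hex, fun k hk => Nat.find_min hex hk⟩
  refine ⟨m, hm, fun k hk => ?_⟩
  have := hmin k hk
  simp only [node] at this hk ⊢
  rwa [floor_div _ _ hk.le]

/-- Strong subadditivity, in the form in which it is used. -/
lemma cost_maxl_union_add_le (s : ℝ) {S T : Set (ℕ × ℤ)} {E : Set ℝ}
    (hS : Covers S E) (hT : Covers T E) :
    cost s (maxl (S ∪ T)) + content s E ≤ cost s S + cost s T := by
  -- Each point lies in a member of `S` and a member of `T`. Either these coincide, or the finer one
  -- is not maximal in the union.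
  have hcov : Covers ((S ∩ T) ∪ ((S ∪ T) \ maxl (S ∪ T))) E := by
    intro x hx
    obtain ⟨k, hk⟩ := hS x hx
    obtain ⟨l, hl⟩ := hT x hx
    have key : ∀ a b : ℕ, a < b → node a x ∈ S ∪ T → node b x ∈ S ∪ T →
        node b x ∈ (S ∪ T) \ maxl (S ∪ T) := fun a b hab ha hb =>
      ⟨hb, fun hm => hm.2 a hab (by
        simp only [node] at ha ⊢
        rwa [floor_div _ _ hab.le])⟩
    rcases lt_trichotomy k l with h | h | h
    · exact ⟨l, Or.inr (key k l h (Or.inl hk) (Or.inr hl))⟩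
    · subst h; exact ⟨k, Or.inl ⟨hk, hl⟩⟩
    · exact ⟨k, Or.inr (key l k h (Or.inr hl) (Or.inl hk))⟩
  have hsub : maxl (S ∪ T) ⊆ S ∪ T := fun p hp => hp.1
  have hm : ∀ S : Set (ℕ × ℤ), MeasurableSet S := fun S => S.to_countable.measurableSet
  calc cost s (maxl (S ∪ T)) + content s E
      ≤ cost s (maxl (S ∪ T)) + (cost s (S ∩ T) + cost s ((S ∪ T) \ maxl (S ∪ T))) := by
        gcongr
        exact (content_le hcov).trans (measure_union_le _ _)
    _ = cost s (S ∩ T) + (cost s ((S ∪ T) \ maxl (S ∪ T)) + cost s ((S ∪ T) ∩ maxl (S ∪ T))) := by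
        rw [inter_eq_self_of_subset_right hsub]; ring
    _ = cost s (S ∪ T) + cost s (S ∩ T) := by
        rw [measure_sdiff_add_inter _ (hm _)]
        ring
    _ = cost s S + cost s T := measure_union_add_inter S (hm T)

/-- The increasing sets lemma for the dyadic content. -/
lemma content_iUnion_of_monotone (s : ℝ) {E : ℕ → Set ℝ} (hE : Monotone E) :
    content s (⋃ n, E n) = ⨆ n, content s (E n) := by
  refine le_antisymm ?_ (iSup_le fun n => content_mono s (subset_iUnion E n))
  refine ENNReal.le_of_forall_pos_le_add fun ε hε hfin => ?_
  have hlt : ∀ n, content s (E n) < ∞ := fun n =>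
    (le_iSup (fun n => content s (E n)) n).trans_lt hfin
  obtain ⟨δ, hδ, hδsum⟩ := ENNReal.exists_pos_sum_of_countable (ENNReal.coe_ne_zero.2 hε.ne') ℕ
  have hS : ∀ n, ∃ S, Covers S (E n) ∧ cost s S < content s (E n) + δ n := fun n => by
    have h1 := ENNReal.lt_add_right (hlt n).ne (ENNReal.coe_ne_zero.2 (hδ n).ne')
    nth_rw 1 [content] at h1
    simpa only [iInf_lt_iff, exists_prop] using h1
  choose S hS hS' using hS
  set D : ℕ → Set (ℕ × ℤ) := fun n => ⋃ m ∈ Iic n, S m with hD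
  have hDmono : Monotone D := fun a b hab =>
    biUnion_subset_biUnion_left (Iic_subset_Iic.2 hab)
  have hDs : ∀ n, D (n + 1) = D n ∪ S (n + 1) := fun n => by
    simp only [hD]
    rw [show Iic (n + 1) = Iic n ∪ {n + 1} by ext; simp; omega, biUnion_union]
    simp
  have hDcov : ∀ n, Covers (maxl (D n)) (E n) := fun n => covers_maxl fun x hx =>
    (hS n x hx).imp fun k hk => mem_biUnion (mem_Iic.2 le_rfl) hk
  -- Both `maxl (D n)` and `S (n + 1)` cover `E n`, so strong subadditivity lets the content of `E
  -- n` cancel; the errors `δ i` merely add up.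
  have hind : ∀ n, cost s (maxl (D n)) ≤ content s (E n) + ∑ i ∈ Finset.range (n + 1), (δ i : ℝ≥0∞) := by
    intro n
    induction n with
    | zero =>
      have : maxl (D 0) ⊆ S 0 := fun p hp => by
        have := hp.1
        simpa [hD] using this
      simpa using (measure_mono this).trans (hS' 0).le
    | succ n ih =>
      have hsub : maxl (D (n + 1)) ⊆ maxl (maxl (D n) ∪ S (n + 1)) := by
        rintro p ⟨hp, hp'⟩
        rw [hDs] at hp hp'
        refine ⟨?_, fun k hk hk' => hp' k hk ?_⟩
        · rcases hp with hp | hp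
          · exact Or.inl ⟨hp, fun k hk hk' => hp' k hk (Or.inl hk')⟩
          · exact Or.inr hp
        · exact hk'.imp (fun h => h.1) id
      have h1 := cost_maxl_union_add_le s (hDcov n)
        (fun x hx => hS (n + 1) x (hE n.le_succ hx))
      have h2 : cost s (maxl (D (n + 1))) + content s (E n) ≤
          (content s (E (n + 1)) + ∑ i ∈ Finset.range (n + 2), (δ i : ℝ≥0∞)) + content s (E n) := by
        calc _ ≤ _ := (add_le_add_left (measure_mono hsub) _).trans h1
          _ ≤ _ := add_le_add ih (hS' (n + 1)).le
          _ = _ := by rw [Finset.sum_range_succ _ (n + 1)]; ring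
      exact (ENNReal.add_le_add_iff_right (hlt n).ne).1 h2
  have hcov : Covers (maxl (⋃ n, D n)) (⋃ n, E n) := by
    refine covers_maxl fun x hx => ?_
    obtain ⟨n, hn⟩ := mem_iUnion.1 hx
    obtain ⟨k, hk⟩ := hDcov n x hn
    exact ⟨k, mem_iUnion.2 ⟨n, hk.1⟩⟩
  refine (content_le hcov).trans ?_
  have hU : maxl (⋃ n, D n) = ⋃ n, maxl (⋃ n, D n) ∩ D n := by
    rw [← inter_iUnion, inter_eq_self_of_subset_left]
    exact fun p hp => hp.1
  have hmono : Monotone fun n => maxl (⋃ n, D n) ∩ D n := fun a b hab =>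
    inter_subset_inter_right _ (hDmono hab)
  rw [hU, hmono.measure_iUnion]
  refine iSup_le fun n => ?_
  have hsub : maxl (⋃ n, D n) ∩ D n ⊆ maxl (D n) := fun p hp =>
    ⟨hp.2, fun k hk hk' => hp.1.2 k hk (mem_iUnion.2 ⟨n, hk'⟩)⟩
  calc _ ≤ _ := (measure_mono hsub).trans (hind n)
    _ ≤ _ := add_le_add (le_iSup (fun n => content s (E n)) n)
        ((ENNReal.sum_le_tsum _).trans hδsum.le)

lemma node_eq_iff {k : ℕ} {i : ℤ} {x : ℝ} :
    node k x = (k, i) ↔ (i : ℝ) / 2 ^ k ≤ x ∧ x < (i + 1) / 2 ^ k := by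
  have h2 : (0 : ℝ) < 2 ^ k := by positivity
  rw [node, Prod.mk.injEq, Int.floor_eq_iff, div_le_iff₀ h2, lt_div_iff₀ h2, mul_comm]
  simp

lemma cost_image_shift (s : ℝ) (S : Set (ℕ × ℤ)) :
    cost s ((fun p => (p.1, p.2 - 1)) '' S) = cost s S := by
  have hinj : Function.Injective (fun p : ℕ × ℤ => (p.1, p.2 - 1)) := by
    rintro ⟨a, b⟩ ⟨c, d⟩ h
    simp only [Prod.mk.injEq] at h ⊢
    omega
  have hm : ∀ S : Set (ℕ × ℤ), MeasurableSet S := fun S => S.to_countable.measurableSet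
  have h : ∀ T : Set (ℕ × ℤ), cost s T = ∑' p : T, ENNReal.ofReal ((2 : ℝ) ^ (-((p : ℕ × ℤ).1 * s))) := by
    intro T
    rw [cost, withDensity_apply _ (hm T), ← lintegral_indicator (hm T), lintegral_count,
      tsum_subtype T fun p : ℕ × ℤ => ENNReal.ofReal ((2 : ℝ) ^ (-(p.1 * s)))]
  rw [h, h]
  exact tsum_image (fun p : ℕ × ℤ => ENNReal.ofReal ((2 : ℝ) ^ (-(p.1 * s)))) hinj.injOn

/-- A set is contained in an open set of comparable dyadic content. -/
lemma exists_isOpen_content_le {s : ℝ} {E : Set ℝ} {S : Set (ℕ × ℤ)} (hS : Covers S E) :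
    ∃ U, IsOpen U ∧ E ⊆ U ∧ content s U ≤ 2 * cost s S := by
  -- Each interval is extended to the left by its own length. The result is covered by the interval
  -- and its left neighbour, whence the factor 2.
  refine ⟨⋃ p ∈ S, Ioo (((p.2 : ℝ) - 1) / 2 ^ p.1) ((p.2 + 1) / 2 ^ p.1),
    isOpen_biUnion fun _ _ => isOpen_Ioo, fun x hx => ?_, ?_⟩
  · obtain ⟨k, hk⟩ := hS x hx
    refine mem_biUnion hk ?_
    have h := node_eq_iff.1 (show node k x = (k, ⌊(2 : ℝ) ^ k * x⌋) from rfl)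
    exact ⟨lt_of_lt_of_le (by simp only [node]; gcongr; linarith) h.1, h.2⟩
  · have hc : Covers (S ∪ (fun p => (p.1, p.2 - 1)) '' S)
        (⋃ p ∈ S, Ioo (((p.2 : ℝ) - 1) / 2 ^ p.1) ((p.2 + 1) / 2 ^ p.1)) := by
      intro x hx
      simp only [mem_iUnion] at hx
      obtain ⟨⟨k, i⟩, hp, hx⟩ := hx
      refine ⟨k, ?_⟩
      rcases le_or_gt ((i : ℝ) / 2 ^ k) x with h | h
      · left
        rwa [node_eq_iff.2 ⟨h, hx.2⟩]
      · right
        refine ⟨_, hp, ?_⟩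
        rw [eq_comm, node_eq_iff]
        push_cast
        exact ⟨hx.1.le, by simpa using h⟩
    refine (content_le hc).trans ((measure_union_le _ _).trans ?_)
    rw [cost_image_shift, two_mul]

/-- Capacitability of analytic sets for the dyadic content. -/
lemma exists_isCompact_content_pos {s : ℝ} {E : Set ℝ} (hE : AnalyticSet E)
    (h : 0 < content s E) : ∃ K ⊆ E, IsCompact K ∧ 0 < content s K := by
  rw [AnalyticSet] at hE
  rcases hE with rfl | ⟨f, hf, rfl⟩
  · simp [content_empty] at h
  obtain ⟨t, ht0, ht⟩ := exists_between h
  -- Bounding one more coordinate keeps the content above `t`, by continuity along increasing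
  -- unions.
  have hstep : ∀ (S : {S : Set (ℕ → ℕ) // t < content s (f '' S)}) (k : ℕ),
      ∃ m, t < content s (f '' (S.1 ∩ {x | x k ≤ m})) := by
    rintro ⟨S, hS⟩ k
    have hmono : Monotone fun m => f '' (S ∩ {x : ℕ → ℕ | x k ≤ m}) := fun a b hab =>
      image_mono (inter_subset_inter_right _ fun x hx => le_trans hx hab)
    have hU : f '' S = ⋃ m, f '' (S ∩ {x : ℕ → ℕ | x k ≤ m}) := by
      rw [← image_iUnion, ← inter_iUnion, inter_eq_self_of_subset_left]
      exact fun x _ => mem_iUnion.2 ⟨x k, le_refl (x k)⟩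
    rw [hU, content_iUnion_of_monotone s hmono] at hS
    exact lt_iSup_iff.1 hS
  choose g hg using hstep
  let T : ℕ → {S : Set (ℕ → ℕ) // t < content s (f '' S)} := fun k =>
    Nat.rec ⟨univ, by rwa [image_univ]⟩ (fun k S => ⟨S.1 ∩ {x | x k ≤ g S k}, hg S k⟩) k
  set n : ℕ → ℕ := fun k => g (T k) k
  have hT : ∀ k, (T k).1 = {x | ∀ i < k, x i ≤ n i} := by
    intro k
    induction k with
    | zero => simp [T]
    | succ k ih =>
      have : (T (k + 1)).1 = (T k).1 ∩ {x | x k ≤ n k} := rfl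
      rw [this, ih]
      ext x
      simp only [mem_inter_iff, mem_ofPred_eq, Nat.lt_succ_iff_lt_or_eq]
      constructor
      · rintro ⟨h1, h2⟩ i (hi | rfl)
        exacts [h1 i hi, h2]
      · exact fun h => ⟨fun i hi => h i (Or.inl hi), h k (Or.inr rfl)⟩
  set L : Set (ℕ → ℕ) := Set.pi univ fun i => Iic (n i)
  have hL : IsCompact L := isCompact_univ_pi fun i => (finite_Iic (n i)).isCompact
  refine ⟨f '' L, image_subset_range f L, hL.image hf, ?_⟩
  by_contra hzero
  -- Half of `t`, because passing to an open superset costs a factor 2.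
  have hlt : content s (f '' L) < t / 2 := by
    rw [not_lt, nonpos_iff_eq_zero] at hzero
    rw [hzero]
    exact ENNReal.half_pos ht0.ne'
  simp only [content, iInf_lt_iff] at hlt
  obtain ⟨S, hS, hSt⟩ := hlt
  obtain ⟨U, hUo, hLU, hU⟩ := exists_isOpen_content_le (s := s) hS
  have hnhds : ∀ x ∈ L, ∃ k : ℕ, PiNat.cylinder x k ⊆ f ⁻¹' U := fun x hx => by
    obtain ⟨k, hk⟩ := (PiNat.isTopologicalBasis_cylinders (fun _ : ℕ => ℕ)).mem_nhds_iff.1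
      ((hUo.preimage hf).mem_nhds (hLU (mem_image_of_mem f hx)))
    obtain ⟨⟨y, m, rfl⟩, hxy, hsub⟩ := hk
    exact ⟨m, by rwa [PiNat.mem_cylinder_iff_eq.1 hxy]⟩
  choose! κ hκ using hnhds
  obtain ⟨F, hFL, hF⟩ := hL.elim_nhds_subcover (fun x => PiNat.cylinder x (κ x))
    fun x _ => (PiNat.isOpen_cylinder (fun _ : ℕ => ℕ) x (κ x)).mem_nhds (PiNat.self_mem_cylinder x (κ x))
  set N := F.sup κ
  have hsub : f '' (T N).1 ⊆ U := by
    rintro _ ⟨y, hy, rfl⟩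
    rw [hT] at hy
    -- Truncating `y` by zeros puts it in `L` without changing the coordinates below `N`, the only
    -- ones the finite subcover sees.
    set z : ℕ → ℕ := fun i => if i < N then y i else 0
    have hz : z ∈ L := fun i _ => by
      by_cases hi : i < N
      · simpa [z, hi] using hy i hi
      · simp [z, hi]
    obtain ⟨x, hx, hzx⟩ := mem_iUnion₂.1 (hF hz)
    refine hκ x (hFL x hx) fun i hi => ?_
    have hiN : i < N := hi.trans_le (Finset.le_sup hx)
    simpa [z, hiN] using hzx i hi
  have : t < t := calc
    t < content s (f '' (T N).1) := (T N).2
    _ ≤ 2 * cost s S := (content_mono s hsub).trans hU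
    _ ≤ 2 * (t / 2) := by gcongr
    _ = t := ENNReal.mul_div_cancel (by simp) (by simp)
  exact lt_irrefl _ this

/-! ### From Hausdorff dimension to dyadic content -/

lemma ediam_cell_le (p : ℕ × ℤ) :
    Metric.ediam (cell p) ≤ ENNReal.ofReal ((2 : ℝ) ^ (-(p.1 : ℝ))) := by
  obtain ⟨k, i⟩ := p
  have : cell (k, i) ⊆ Icc ((i : ℝ) / 2 ^ k) ((i + 1) / 2 ^ k) := fun x hx => by
    have := node_eq_iff.1 hx
    exact ⟨this.1, this.2.le⟩
  refine (Metric.ediam_mono this).trans ?_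
  rw [Real.ediam_Icc]
  apply ENNReal.ofReal_le_ofReal
  rw [Real.rpow_neg (by norm_num), Real.rpow_natCast]
  apply le_of_eq
  field_simp
  ring

/-- A set of zero dyadic content has zero Hausdorff measure. -/
lemma hausdorffMeasure_eq_zero_of_content_eq_zero {s : ℝ} (hs : 0 < s) {E : Set ℝ}
    (h : content s E = 0) : μH[s] E = 0 := by
  have hex : ∀ n : ℕ, ∃ S, Covers S E ∧ cost s S ≤ (n : ℝ≥0∞)⁻¹ := fun n => by
    have : content s E < (n : ℝ≥0∞)⁻¹ := by rw [h]; simp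
    simp only [content, iInf_lt_iff] at this
    obtain ⟨S, hS, hS'⟩ := this
    exact ⟨S, hS, hS'.le⟩
  choose S hS hS' using hex
  classical
  have hm : ∀ S : Set (ℕ × ℤ), MeasurableSet S := fun S => S.to_countable.measurableSet
  have hpow : ∀ p : ℕ × ℤ, ENNReal.ofReal ((2 : ℝ) ^ (-(p.1 : ℝ))) ^ s =
      ENNReal.ofReal ((2 : ℝ) ^ (-(p.1 * s))) := fun p => by
    rw [ENNReal.ofReal_rpow_of_nonneg (by positivity) hs.le, ← Real.rpow_mul (by norm_num)]
    ring_nf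
  have hdiam : ∀ p, Metric.ediam (cell p) ^ s ≤ cost s {p} := fun p => by
    rw [cost_singleton, ← hpow]
    exact ENNReal.rpow_le_rpow (ediam_cell_le p) hs.le
  have hlim : Tendsto (fun n : ℕ => (n : ℝ≥0∞)⁻¹) atTop (𝓝 0) := ENNReal.tendsto_inv_nat_nhds_zero
  have key := Measure.hausdorffMeasure_le_liminf_tsum (ι := fun _ : ℕ => ℕ × ℤ) s E (l := atTop)
    -- A single interval costs no more than the whole family, so total cost at most 1/n forces every
    -- diameter below n^(-1/s).
    (fun n => ((n : ℝ≥0∞)⁻¹) ^ s⁻¹)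
    (by
      have := (ENNReal.continuous_rpow_const (y := s⁻¹)).tendsto (0 : ℝ≥0∞)
      rw [ENNReal.zero_rpow_of_pos (inv_pos.2 hs)] at this
      exact this.comp hlim)
    (fun n p => if p ∈ S n then cell p else ∅)
    (Eventually.of_forall fun n p => by
      split_ifs with hp
      · rw [ENNReal.le_rpow_inv_iff hs]
        exact (hdiam p).trans ((measure_mono (singleton_subset_iff.2 hp)).trans (hS' n))
      · simp)
    (Eventually.of_forall fun n x hx => by
      obtain ⟨k, hk⟩ := hS n x hx
      refine mem_iUnion.2 ⟨node k x, ?_⟩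
      rw [if_pos hk]
      rfl)
  refine le_antisymm (key.trans ?_) bot_le
  have hle : ∀ n : ℕ, ∑' p, Metric.ediam (if p ∈ S n then cell p else ∅) ^ s ≤ (n : ℝ≥0∞)⁻¹ := by
    intro n
    refine le_trans ?_ (hS' n)
    rw [cost, withDensity_apply _ (hm _), ← lintegral_indicator (hm _), lintegral_count]
    refine ENNReal.tsum_le_tsum fun p => ?_
    by_cases hp : p ∈ S n
    · simpa [hp, cost_singleton] using hdiam p
    · simp [hp, hs]
  calc _ ≤ liminf (fun n : ℕ => (n : ℝ≥0∞)⁻¹) atTop := liminf_le_liminf (Eventually.of_forall hle)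
    _ = 0 := hlim.liminf_eq

/-- Every Borel set of dimension larger than `s` contains a compact set of positive
`s`-dimensional dyadic content inside an interval `[i, i + 1)`. -/
lemma exists_isCompact_subset_cell {s : ℝ≥0} (hs : 0 < s) {E : Set ℝ} (hE : MeasurableSet E)
    (h : s < dimH E) : ∃ (K : Set ℝ) (i : ℤ), K ⊆ E ∧ K ⊆ cell (0, i) ∧ IsCompact K ∧
      0 < content s K := by
  have hU : E = ⋃ i : ℤ, E ∩ cell (0, i) := by
    rw [← inter_iUnion, inter_eq_self_of_subset_left]
    exact fun x _ => mem_iUnion.2 ⟨⌊(2 : ℝ) ^ 0 * x⌋, rfl⟩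
  rw [hU, dimH_iUnion] at h
  obtain ⟨i, hi⟩ := lt_iSup_iff.1 h
  have hcell : MeasurableSet (cell (0, i)) := by
    have : cell (0, i) = (fun x : ℝ => ⌊(2 : ℝ) ^ 0 * x⌋) ⁻¹' {i} := by
      ext x
      exact ⟨fun h => congrArg Prod.snd h, fun h => Prod.ext rfl h⟩
    rw [this]
    exact (Int.measurable_floor.comp (measurable_const_mul _)) (measurableSet_singleton i)
  have hpos : 0 < content s (E ∩ cell (0, i)) := by
    rw [pos_iff_ne_zero]
    intro h0
    have := hausdorffMeasure_of_lt_dimH hi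
    rw [hausdorffMeasure_eq_zero_of_content_eq_zero (by exact_mod_cast hs) h0] at this
    exact ENNReal.zero_ne_top this
  obtain ⟨K, hK, hKc, hKpos⟩ := exists_isCompact_content_pos (hE.inter hcell).analyticSet hpos
  exact ⟨K, i, hK.trans inter_subset_left, hK.trans inter_subset_right, hKc, hKpos⟩

/-! ### Frostman's lemma -/

/-- A mass distribution on the binary tree dominated by a subadditive set function: the mass of
each node is split among its children in proportion to their capacities. -/
lemma exists_tree_mass (c : ℕ → ℤ → ℝ) (h0 : ∀ k j, 0 ≤ c k j)
    (hc : ∀ k j, c k j ≤ c (k + 1) (2 * j) + c (k + 1) (2 * j + 1)) :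
    ∃ m : ℕ → ℤ → ℝ, (∀ k j, 0 ≤ m k j) ∧ (∀ k j, m k j ≤ c k j) ∧ (∀ j, m 0 j = c 0 j) ∧
      ∀ k j, m (k + 1) (2 * j) + m (k + 1) (2 * j + 1) = m k j := by
  let m : ℕ → ℤ → ℝ := fun k => Nat.rec (c 0) (fun k f j =>
    f (j / 2) * (c (k + 1) j / (c (k + 1) (2 * (j / 2)) + c (k + 1) (2 * (j / 2) + 1)))) k
  have hm : ∀ k j, m (k + 1) j =
      m k (j / 2) * (c (k + 1) j / (c (k + 1) (2 * (j / 2)) + c (k + 1) (2 * (j / 2) + 1))) :=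
    fun _ _ => rfl
  have hnn : ∀ k j, 0 ≤ m k j := by
    intro k
    induction k with
    | zero => exact h0 0
    | succ k ih =>
      intro j
      rw [hm]
      have := h0 (k + 1) (2 * (j / 2))
      have := h0 (k + 1) (2 * (j / 2) + 1)
      have := h0 (k + 1) j
      have := ih (j / 2)
      positivity
  have hle : ∀ k j, m k j ≤ c k j := by
    intro k
    induction k with
    | zero => exact fun j => le_rfl
    | succ k ih =>
      intro j
      rw [hm]
      have h1 := (ih (j / 2)).trans (hc k (j / 2))
      have h2 := h0 (k + 1) j
      rw [mul_div_assoc', mul_comm, mul_div_assoc]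
      exact mul_le_of_le_one_right h2 (div_le_one_of_le₀ h1 (add_nonneg (h0 _ _) (h0 _ _)))
  refine ⟨m, hnn, hle, fun j => rfl, fun k j => ?_⟩
  rw [hm, hm, show 2 * j / 2 = j by omega, show (2 * j + 1) / 2 = j by omega, ← mul_add,
    ← add_div]
  -- If both children have capacity 0, the quotients are 0 by convention; the parent then has no
  -- mass to pass on.
  rcases eq_or_ne (c (k + 1) (2 * j) + c (k + 1) (2 * j + 1)) 0 with h | h
  · have : m k j = 0 := le_antisymm (((hle k j).trans (hc k j)).trans h.le) (hnn k j)
    rw [this, zero_mul]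
  · rw [div_self h, mul_one]

/-- A mass distribution on dyadic intervals has a distribution function, up to one interval. -/
lemma exists_monotone_of_tree_mass (m : ℕ → ℤ → ℝ) (h0 : ∀ k j, 0 ≤ m k j)
    (hm : ∀ k j, m (k + 1) (2 * j) + m (k + 1) (2 * j + 1) = m k j) (a : ℤ) :
    ∃ F : ℝ → ℝ, Monotone F ∧ ∀ k x,
      ∑ j ∈ Finset.Ico (a * 2 ^ k) ⌊(2 : ℝ) ^ k * x⌋, m k j ≤ F x ∧
      F x ≤ ∑ j ∈ Finset.Ico (a * 2 ^ k) (⌊(2 : ℝ) ^ k * x⌋ + 1), m k j := by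
  set G : ℕ → ℤ → ℝ := fun k n => ∑ j ∈ Finset.Ico (a * 2 ^ k) n, m k j with hG
  have hGmono : ∀ k, Monotone (G k) := fun k x y hxy =>
    Finset.sum_le_sum_of_subset_of_nonneg (Finset.Ico_subset_Ico_right hxy) fun j _ _ => h0 k j
  have hG2 : ∀ k n, G (k + 1) (2 * n) = G k n := by
    intro k n
    rcases le_total n (a * 2 ^ k) with h | h
    · have h1 : 2 * n ≤ a * 2 ^ (k + 1) := by rw [pow_succ]; linarith
      simp [hG, Finset.Ico_eq_empty_of_le h, Finset.Ico_eq_empty_of_le h1]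
    · induction n, h using Int.leInduction with
      | base => simp [hG, pow_succ, show 2 * (a * 2 ^ k) = a * (2 ^ k * 2) by ring]
      | succ n hn ih =>
        have h1 : a * 2 ^ (k + 1) ≤ 2 * n := by rw [pow_succ]; linarith
        have hs : ∀ k (n : ℤ), a * 2 ^ k ≤ n → G k (n + 1) = G k n + m k n := fun k n h => by
          simp only [hG]
          rw [← Finset.insert_Ico_right_eq_Ico_add_one h,
            Finset.sum_insert Finset.right_notMem_Ico, add_comm]
        rw [show 2 * (n + 1) = 2 * n + 1 + 1 by ring, hs _ _ (by omega), hs _ _ h1, ih, hs _ _ hn,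
          add_assoc, hm]
  have hfl : ∀ k (x : ℝ), 2 * ⌊(2 : ℝ) ^ k * x⌋ ≤ ⌊(2 : ℝ) ^ (k + 1) * x⌋ ∧
      ⌊(2 : ℝ) ^ (k + 1) * x⌋ + 1 ≤ 2 * (⌊(2 : ℝ) ^ k * x⌋ + 1) := fun k x => by
    have := floor_div k (k + 1) k.le_succ x
    rw [Nat.add_sub_cancel_left, pow_one] at this
    omega
  -- Refining the level raises the mass strictly left of the interval of `x` and lowers the mass
  -- that includes this interval; the supremum of the former lies between them at every level.
  have hlow : ∀ x : ℝ, Monotone fun k => G k ⌊(2 : ℝ) ^ k * x⌋ := fun x =>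
    monotone_nat_of_le_succ fun k => by
      rw [← hG2]
      exact hGmono _ (hfl k x).1
  have hup : ∀ x : ℝ, Antitone fun k => G k (⌊(2 : ℝ) ^ k * x⌋ + 1) := fun x =>
    antitone_nat_of_succ_le fun k => by
      rw [← hG2 k]
      exact hGmono _ (hfl k x).2
  have hlu : ∀ (x : ℝ) k l, G l ⌊(2 : ℝ) ^ l * x⌋ ≤ G k (⌊(2 : ℝ) ^ k * x⌋ + 1) := fun x k l =>
    ((hlow x (le_max_right k l)).trans (hGmono _ (by omega))).trans (hup x (le_max_left k l))
  have hbdd : ∀ x : ℝ, BddAbove (range fun k => G k ⌊(2 : ℝ) ^ k * x⌋) := fun x =>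
    ⟨_, by rintro _ ⟨l, rfl⟩; exact hlu x 0 l⟩
  refine ⟨fun x => ⨆ k, G k ⌊(2 : ℝ) ^ k * x⌋, fun x y hxy => ?_, fun k x =>
    ⟨le_ciSup (hbdd x) k, ciSup_le (hlu x k)⟩⟩
  exact ciSup_mono (hbdd y) fun k => hGmono k (Int.floor_le_floor (by gcongr))

lemma sum_Ico_le_of_tree_mass {f : ℤ → ℝ} (h0 : ∀ j, 0 ≤ f j) (a p q : ℤ) :
    ∑ j ∈ Finset.Ico a q, f j - ∑ j ∈ Finset.Ico a p, f j ≤ ∑ j ∈ Finset.Ico p q, f j := by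
  rw [sub_le_iff_le_add', ← Finset.sum_union_inter]
  refine (Finset.sum_le_sum_of_subset_of_nonneg (fun j hj => ?_) fun j _ _ => h0 j).trans
    (le_add_of_nonneg_right (Finset.sum_nonneg fun j _ => h0 j))
  simp only [Finset.mem_union, Finset.mem_Ico] at hj ⊢
  omega

lemma content_cell_le_children (s : ℝ) (K : Set ℝ) (k : ℕ) (j : ℤ) :
    content s (K ∩ cell (k, j)) ≤
      content s (K ∩ cell (k + 1, 2 * j)) + content s (K ∩ cell (k + 1, 2 * j + 1)) := by
  refine (content_mono s ?_).trans (content_union_le s _ _)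
  rintro x ⟨hx, hxc⟩
  have h1 : ⌊(2 : ℝ) ^ k * x⌋ = j := congrArg Prod.snd hxc
  have h2 := floor_div k (k + 1) k.le_succ x
  rw [Nat.add_sub_cancel_left, pow_one, h1] at h2
  rcases Int.emod_two_eq_zero_or_one ⌊(2 : ℝ) ^ (k + 1) * x⌋ with h | h
  · exact Or.inl ⟨hx, Prod.ext rfl (by simp only [node]; omega)⟩
  · exact Or.inr ⟨hx, Prod.ext rfl (by simp only [node]; omega)⟩

/-- **Frostman's lemma** for compact sets, on dyadic scales. -/
lemma exists_measure_of_content_pos {s : ℝ} {K : Set ℝ} (hK : IsCompact K)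
    {a : ℤ} (hKa : K ⊆ cell (0, a)) (hpos : 0 < content s K) :
    ∃ μ : Measure ℝ, IsFiniteMeasure μ ∧ μ ≠ 0 ∧ μ Kᶜ = 0 ∧
      ∀ (k : ℕ) (x y : ℝ), y - x ≤ 1 / 2 ^ k →
        μ (Ioc x y) ≤ ENNReal.ofReal (3 * (2 : ℝ) ^ (-(k * s))) := by
  set c : ℕ → ℤ → ℝ := fun k j => (content s (K ∩ cell (k, j))).toReal with hc
  have hfin : ∀ k j, content s (K ∩ cell (k, j)) ≠ ∞ := fun k j =>
    ne_top_of_le_ne_top ENNReal.ofReal_ne_top (content_inter_cell_le s K (k, j))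
  have hcle : ∀ k j, c k j ≤ (2 : ℝ) ^ (-(k * s)) := fun k j =>
    ENNReal.toReal_le_of_le_ofReal (by positivity) (content_inter_cell_le s K (k, j))
  obtain ⟨m, hm0, hmc, hmz, hmadd⟩ := exists_tree_mass c (fun _ _ => ENNReal.toReal_nonneg)
    fun k j => by
      simp only [hc]
      rw [← ENNReal.toReal_add (hfin _ _) (hfin _ _)]
      exact ENNReal.toReal_mono (ENNReal.add_ne_top.2 ⟨hfin _ _, hfin _ _⟩)
        (content_cell_le_children s K k j)
  obtain ⟨F, hF, hFm⟩ := exists_monotone_of_tree_mass m hm0 hmadd a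
  set μ := hF.stieltjesFunction.measure with hμ
  -- The extra 2 in the upper index: one interval for the upper bound on `F`, one for the right
  -- limit, which is bounded by the value at `y + 1 / 2 ^ k`.
  have hIoc : ∀ (k : ℕ) (x y : ℝ), μ (Ioc x y) ≤ ENNReal.ofReal
      (∑ j ∈ Finset.Ico ⌊(2 : ℝ) ^ k * x⌋ (⌊(2 : ℝ) ^ k * y⌋ + 2), m k j) := by
    intro k x y
    rw [hμ, StieltjesFunction.measure_Ioc]
    apply ENNReal.ofReal_le_ofReal
    have h1 : F x ≤ hF.stieltjesFunction x := by
      rw [Monotone.stieltjesFunction_eq]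
      exact hF.le_rightLim le_rfl
    have h2 : hF.stieltjesFunction y ≤ F (y + 1 / 2 ^ k) := by
      rw [Monotone.stieltjesFunction_eq]
      exact hF.rightLim_le (lt_add_of_pos_right _ (by positivity))
    have h3 : ⌊(2 : ℝ) ^ k * (y + 1 / 2 ^ k)⌋ = ⌊(2 : ℝ) ^ k * y⌋ + 1 := by
      rw [mul_add, mul_one_div_cancel (by positivity), Int.floor_add_one]
    have h4 := (hFm k (y + 1 / 2 ^ k)).2
    rw [h3, show ⌊(2 : ℝ) ^ k * y⌋ + 1 + 1 = ⌊(2 : ℝ) ^ k * y⌋ + 2 by ring] at h4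
    refine le_trans ?_ (sum_Ico_le_of_tree_mass (hm0 k) (a * 2 ^ k) _ _)
    linarith [(hFm k x).1]
  -- Near a point off `K`, at a scale below a quarter of the distance, all intervals that count miss
  -- `K` and so have capacity zero.
  have hnull : μ Kᶜ = 0 := by
    refine measure_null_of_locally_null _ fun x hx => ?_
    obtain ⟨ε, hε, hball⟩ := Metric.isOpen_iff.1 hK.isClosed.isOpen_compl x hx
    obtain ⟨k, hk⟩ := exists_pow_lt_of_lt_one (show 0 < ε / 4 by positivity)
      (show (1 / 2 : ℝ) < 1 by norm_num)
    rw [one_div_pow] at hk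
    have h2k : (0 : ℝ) < 1 / 2 ^ k := by positivity
    refine ⟨Ioc (x - 1 / 2 ^ k) (x + 1 / 2 ^ k), mem_nhdsWithin_of_mem_nhds
      (Ioc_mem_nhds (by linarith) (by linarith)), le_antisymm ((hIoc k _ _).trans
      (ENNReal.ofReal_eq_zero.2 (Finset.sum_nonpos fun j hj => ?_)).le) bot_le⟩
    refine (hmc k j).trans (le_of_eq ?_)
    have hempty : K ∩ cell (k, j) = ∅ := by
      refine eq_empty_of_forall_notMem fun z ⟨hzK, hz⟩ => hball ?_ hzK
      rw [Finset.mem_Ico] at hj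
      have hp : (0 : ℝ) < 2 ^ k := by positivity
      have hz1 : ⌊(2 : ℝ) ^ k * z⌋ = j := congrArg Prod.snd hz
      have hz2 := Int.floor_eq_iff.1 hz1
      have e1 : ((2 : ℝ) ^ k) * (x - 1 / 2 ^ k) < j + 1 := by
        exact_mod_cast Int.floor_lt.1 (show ⌊(2 : ℝ) ^ k * (x - 1 / 2 ^ k)⌋ < j + 1 by omega)
      have e2 : ((j - 1 : ℤ) : ℝ) ≤ (2 : ℝ) ^ k * (x + 1 / 2 ^ k) :=
        Int.le_floor.1 (by omega)
      rw [mul_sub, mul_one_div_cancel hp.ne'] at e1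
      rw [mul_add, mul_one_div_cancel hp.ne'] at e2
      push_cast at e2
      have hε : 4 < 2 ^ k * ε := by
        rw [one_div_lt (by positivity) (by positivity)] at hk
        have := (div_lt_iff₀ (by positivity)).1 hk
        field_simp at this
        linarith
      rw [Metric.mem_ball, Real.dist_eq, abs_lt]
      constructor <;> refine lt_of_mul_lt_mul_left ?_ hp.le <;> linarith [hz2.1, hz2.2]
    simp [hc, hempty, content_empty]
  -- This window captures at least the mass of the root, which is the full content of `K`.
  have hmass : 0 < μ (Ioc ((a : ℝ) - 1) (a + 1)) := by
    rw [hμ, StieltjesFunction.measure_Ioc, ENNReal.ofReal_pos, sub_pos]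
    have h1 : F (a + 1) ≤ hF.stieltjesFunction (a + 1) := by
      rw [Monotone.stieltjesFunction_eq]
      exact hF.le_rightLim le_rfl
    have h2 : hF.stieltjesFunction ((a : ℝ) - 1) ≤ F (a - 1 / 2) := by
      rw [Monotone.stieltjesFunction_eq]
      exact hF.rightLim_le (by linarith)
    have h3 := (hFm 0 (a + 1)).1
    have h4 := (hFm 0 (a - 1 / 2)).2
    have e1 : ⌊(2 : ℝ) ^ 0 * ((a : ℝ) + 1)⌋ = a + 1 := by simp
    have e2 : ⌊(2 : ℝ) ^ 0 * ((a : ℝ) - 1 / 2)⌋ = a - 1 := by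
      rw [Int.floor_eq_iff]
      push_cast
      constructor <;> linarith
    rw [e1] at h3
    rw [e2] at h4
    have hca : 0 < m 0 a := by
      rw [hmz]
      refine ENNReal.toReal_pos ?_ (hfin 0 a)
      rw [inter_eq_self_of_subset_left hKa]
      exact hpos.ne'
    have e3 : Finset.Ico a (a + 1) = {a} := by
      ext
      simp
      omega
    rw [pow_zero, mul_one, e3, Finset.sum_singleton] at h3
    rw [pow_zero, mul_one, sub_add_cancel, Finset.Ico_self, Finset.sum_empty] at h4
    linarith
  refine ⟨μ, ⟨?_⟩, fun h => by simp [h] at hmass, hnull, fun k x y hxy => ?_⟩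
  · have hsub : (univ : Set ℝ) ⊆ Kᶜ ∪ Ioc ((a : ℝ) - 1) (a + 1) := fun x _ => by
      by_cases hx : x ∈ K
      · right
        have := node_eq_iff.1 (hKa hx)
        simp only [pow_zero, div_one] at this
        exact ⟨by linarith [this.1], this.2.le⟩
      · exact Or.inl hx
    calc μ univ ≤ μ Kᶜ + μ (Ioc ((a : ℝ) - 1) (a + 1)) :=
          (measure_mono hsub).trans (measure_union_le _ _)
      _ < ∞ := by
        rw [hnull, zero_add]
        exact (hIoc 0 _ _).trans_lt ENNReal.ofReal_lt_top
  · refine (hIoc k x y).trans (ENNReal.ofReal_le_ofReal ?_)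
    have hcard : ((Finset.Ico ⌊(2 : ℝ) ^ k * x⌋ (⌊(2 : ℝ) ^ k * y⌋ + 2)).card : ℝ) ≤ 3 := by
      have : ⌊(2 : ℝ) ^ k * y⌋ ≤ ⌊(2 : ℝ) ^ k * x⌋ + 1 := by
        rw [← Int.floor_add_one]
        apply Int.floor_le_floor
        have := mul_le_mul_of_nonneg_left hxy (show (0 : ℝ) ≤ 2 ^ k by positivity)
        rw [mul_one_div_cancel (by positivity)] at this
        linarith
      rw [Int.card_Ico]
      exact_mod_cast (show (⌊(2 : ℝ) ^ k * y⌋ + 2 - ⌊(2 : ℝ) ^ k * x⌋).toNat ≤ 3 by omega)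
    calc ∑ j ∈ Finset.Ico ⌊(2 : ℝ) ^ k * x⌋ (⌊(2 : ℝ) ^ k * y⌋ + 2), m k j
        ≤ ∑ j ∈ Finset.Ico ⌊(2 : ℝ) ^ k * x⌋ (⌊(2 : ℝ) ^ k * y⌋ + 2), (2 : ℝ) ^ (-(k * s)) :=
          Finset.sum_le_sum fun j _ => (hmc k j).trans (hcle k j)
      _ ≤ 3 * (2 : ℝ) ^ (-(k * s)) := by
        rw [Finset.sum_const, nsmul_eq_mul]
        gcongr

end DyadicContent

/-- The measure `μ` is `s`-dimensional, with constant `C`. -/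
def FrostmanBound (μ : Measure ℝ) (s C : ℝ) : Prop :=
  ∀ x r : ℝ, 0 < r → μ (Ioc x (x + r)) ≤ ENNReal.ofReal (C * r ^ s)

/-- **Frostman's lemma** for Borel sets. -/
theorem exists_frostmanBound {s : ℝ≥0} (hs : 0 < s) {E : Set ℝ} (hE : MeasurableSet E)
    (h : s < dimH E) : ∃ K ⊆ E, IsCompact K ∧ ∃ μ : Measure ℝ, IsFiniteMeasure μ ∧ μ ≠ 0 ∧
      μ Kᶜ = 0 ∧ ∃ C, 0 ≤ C ∧ FrostmanBound μ s C := by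
  obtain ⟨K, a, hKE, hKa, hK, hpos⟩ := DyadicContent.exists_isCompact_subset_cell hs hE h
  obtain ⟨μ, hfin, hne, hnull, hbound⟩ := DyadicContent.exists_measure_of_content_pos hK hKa hpos
  refine ⟨K, hKE, hK, μ, hfin, hne, hnull, 3 * 2 ^ (s : ℝ) + μ.real univ, by positivity,
    fun x r hr => ?_⟩
  rcases le_or_gt 1 r with hr1 | hr1
  · calc μ (Ioc x (x + r)) ≤ μ univ := measure_mono (subset_univ _)
      _ = ENNReal.ofReal (μ.real univ) := (ofReal_measureReal).symm
      _ ≤ _ := by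
        apply ENNReal.ofReal_le_ofReal
        have h1 : 1 ≤ r ^ (s : ℝ) := Real.one_le_rpow hr1 s.2
        have h2 : (0 : ℝ) ≤ 3 * 2 ^ (s : ℝ) := by positivity
        nlinarith [measureReal_nonneg (μ := μ) (s := univ)]
  -- Rounding `r` up to a power of 1/2 at most doubles it, which accounts for the factor 2^s.
  · obtain ⟨k, hk1, hk2⟩ := exists_nat_pow_near_of_lt_one hr hr1.le
      (show (0 : ℝ) < 1 / 2 by norm_num) (show (1 / 2 : ℝ) < 1 by norm_num)
    rw [one_div_pow] at hk1 hk2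
    refine (hbound k x (x + r) (by linarith)).trans (ENNReal.ofReal_le_ofReal ?_)
    have h2 : (2 : ℝ) ^ (-((k : ℝ) * s)) ≤ 2 ^ (s : ℝ) * r ^ (s : ℝ) := by
      rw [← Real.mul_rpow (by norm_num) hr.le, show -((k : ℝ) * s) = (-(k : ℝ)) * s by ring,
        Real.rpow_mul (by norm_num)]
      refine Real.rpow_le_rpow (by positivity) ?_ s.2
      rw [Real.rpow_neg (by norm_num), Real.rpow_natCast]
      rw [pow_succ] at hk1
      have : (1 : ℝ) / (2 ^ k * 2) = (2 ^ k)⁻¹ / 2 := by field_simp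
      linarith
    have h3 : 0 ≤ μ.real univ * r ^ (s : ℝ) := by positivity
    linarith

/-! ### Fourier estimates for Frostman measures -/

lemma lintegral_mul_sq_le {α : Type*} [MeasurableSpace α] (μ : Measure α) {f g : α → ℝ≥0∞}
    (hf : AEMeasurable f μ) (hg : AEMeasurable g μ) :
    (∫⁻ x, f x * g x ∂μ) ^ 2 ≤ (∫⁻ x, f x ^ 2 ∂μ) * ∫⁻ x, g x ^ 2 ∂μ := by
  have h := ENNReal.lintegral_mul_le_Lp_mul_Lq μ Real.HolderConjugate.two_two hf hg
  simp only [ENNReal.rpow_two, Pi.mul_apply] at h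
  calc _ ≤ _ := pow_le_pow_left₀ bot_le h 2
    _ = _ := by
      rw [mul_pow, ← ENNReal.rpow_natCast, ← ENNReal.rpow_natCast, ← ENNReal.rpow_mul,
        ← ENNReal.rpow_mul]
      norm_num

/-- A Gaussian of width `1 / R` sees only the mass at scale `1 / R`. -/
lemma exists_lintegral_gaussian_le {κ : ℝ} (hκ : 0 < κ) : ∃ G : ℝ≥0, ∀ (μ : Measure ℝ) (s C : ℝ),
    0 ≤ C → FrostmanBound μ s C → ∀ R : ℝ, 0 < R → ∀ y,
      ∫⁻ x, ENNReal.ofReal (Real.exp (-κ * (R * (x - y)) ^ 2)) ∂μ ≤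
        G * ENNReal.ofReal (C * R ^ (-s)) := by
  set g : ℤ → ℝ := fun k => Real.exp (κ - κ / 2 * (k : ℝ) ^ 2) with hg
  have hsum : Summable g := by
    have h1 : Summable fun k : ℤ => 2 * Real.exp κ / κ * (1 / (k : ℝ) ^ 2) :=
      (Real.summable_one_div_int_pow.2 (by norm_num)).mul_left _
    refine h1.of_norm_bounded_eventually ?_
    have : ({0}ᶜ : Set ℤ) ∈ cofinite := (finite_singleton 0).compl_mem_cofinite
    filter_upwards [this] with k hk
    have hk2 : (0 : ℝ) < (k : ℝ) ^ 2 := by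
      have : (k : ℝ) ≠ 0 := by exact_mod_cast hk
      positivity
    rw [Real.norm_of_nonneg (Real.exp_nonneg _), Real.exp_sub, div_mul_div_comm, mul_one]
    rw [div_le_div_iff₀ (Real.exp_pos _) (by positivity)]
    have := Real.add_one_le_exp (κ / 2 * (k : ℝ) ^ 2)
    nlinarith [Real.exp_pos κ]
  refine ⟨(∑' k, g k).toNNReal, fun μ s C hC hμ R hR y => ?_⟩
  have hcov : (univ : Set ℝ) ⊆ ⋃ k : ℤ, Ioc (y + k / R) (y + k / R + 1 / R) := fun x _ => by
    refine mem_iUnion.2 ⟨⌈R * (x - y)⌉ - 1, ?_⟩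
    have h1 := Int.le_ceil (R * (x - y))
    have h2 := Int.ceil_lt_add_one (R * (x - y))
    push_cast
    constructor
    · rw [← sub_pos]
      have : x - (y + ((⌈R * (x - y)⌉ : ℝ) - 1) / R) = (R * (x - y) + 1 - ⌈R * (x - y)⌉) / R := by
        field_simp
        ring
      rw [this]
      exact div_pos (by linarith) hR
    · rw [← sub_nonneg]
      have : y + ((⌈R * (x - y)⌉ : ℝ) - 1) / R + 1 / R - x = (⌈R * (x - y)⌉ - R * (x - y)) / R := by
        field_simp
        ring
      rw [this]
      exact div_nonneg (by linarith) hR.le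
  calc ∫⁻ x, ENNReal.ofReal (Real.exp (-κ * (R * (x - y)) ^ 2)) ∂μ
      = ∫⁻ x in univ, ENNReal.ofReal (Real.exp (-κ * (R * (x - y)) ^ 2)) ∂μ := by simp
    _ ≤ ∫⁻ x in ⋃ k : ℤ, Ioc (y + k / R) (y + k / R + 1 / R),
          ENNReal.ofReal (Real.exp (-κ * (R * (x - y)) ^ 2)) ∂μ := lintegral_mono_set hcov
    _ ≤ ∑' k : ℤ, ∫⁻ x in Ioc (y + k / R) (y + k / R + 1 / R),
          ENNReal.ofReal (Real.exp (-κ * (R * (x - y)) ^ 2)) ∂μ := lintegral_iUnion_le _ _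
    _ ≤ ∑' k : ℤ, ENNReal.ofReal (g k) * ENNReal.ofReal (C * R ^ (-s)) := by
        refine ENNReal.tsum_le_tsum fun k => ?_
        have hpt : ∀ x ∈ Ioc (y + k / R) (y + k / R + 1 / R),
            ENNReal.ofReal (Real.exp (-κ * (R * (x - y)) ^ 2)) ≤ ENNReal.ofReal (g k) := by
          intro x hx
          apply ENNReal.ofReal_le_ofReal
          apply Real.exp_le_exp.2
          have h1 : (k : ℝ) < R * (x - y) := by
            have := hx.1
            rw [← lt_sub_iff_add_lt', div_lt_iff₀ hR] at this
            linarith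
          have h2 : R * (x - y) ≤ k + 1 := by
            have := hx.2
            rw [add_assoc, ← add_div, ← sub_le_iff_le_add', le_div_iff₀ hR] at this
            linarith
          have h3 : (k : ℝ) ^ 2 ≤ 2 * (R * (x - y)) ^ 2 + 2 := by
            nlinarith [sq_nonneg (2 * (R * (x - y)) - k)]
          nlinarith
        refine (setLIntegral_mono measurable_const hpt).trans ?_
        rw [setLIntegral_const]
        gcongr
        refine (hμ _ _ (by positivity)).trans (le_of_eq ?_)
        rw [one_div, Real.inv_rpow hR.le, Real.rpow_neg hR.le]
    _ = _ := by
        rw [ENNReal.tsum_mul_right, ← ENNReal.ofReal_tsum_of_nonneg (fun k => Real.exp_nonneg _) hsum]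
        rfl

/-- Smoothing a characteristic function by a Gaussian. -/
lemma integral_gaussian_mul_charFun (μ : Measure ℝ) [IsFiniteMeasure μ] {b : ℝ} (hb : 0 < b)
    (v : ℝ) :
    ∫ u : ℝ, Complex.exp (-b * (u - v) ^ 2) * charFun μ u =
      ∫ x : ℝ, (Real.pi / b : ℂ) ^ (1 / 2 : ℂ) *
        (Complex.exp (v * x * Complex.I) * Complex.exp (-x ^ 2 / (4 * b))) ∂μ := by
  simp_rw [charFun_apply_real, ← integral_const_mul]
  have hint : Integrable (fun u : ℝ => Complex.exp (-b * (u - v) ^ 2)) := by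
    have := (integrable_cexp_neg_mul_sq (b := (b : ℂ)) (by simpa)).comp_sub_right v
    simpa using this
  rw [integral_integral_swap]
  · refine integral_congr_ae (Eventually.of_forall fun x => ?_)
    dsimp only
    have h1 := integral_sub_right_eq_self (μ := volume) (fun w : ℝ =>
      Complex.exp (-b * (w : ℂ) ^ 2) * Complex.exp ((w + v) * x * Complex.I)) v
    have h2 := fourierIntegral_gaussian (b := (b : ℂ)) (by simpa) (x : ℂ)
    rw [mul_left_comm, ← h2, ← integral_const_mul]
    refine Eq.trans ?_ (h1.trans ?_)
    · congr 1
      ext w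
      push_cast
      ring_nf
    · congr 1
      ext w
      rw [← Complex.exp_add, ← Complex.exp_add, ← Complex.exp_add]
      ring_nf
  · refine (hint.comp_fst μ).mono ?_ ?_
    · refine Continuous.aestronglyMeasurable ?_
      simp only [Function.uncurry_def]
      fun_prop
    · refine Eventually.of_forall fun z => ?_
      simp only [Function.uncurry_def, norm_mul]
      rw [show (z.1 : ℂ) * z.2 * Complex.I = ((z.1 * z.2 : ℝ) : ℂ) * Complex.I by push_cast; ring,
        Complex.norm_exp_ofReal_mul_I, mul_one]

lemma enorm_sqrt_pi_div {b : ℝ} (hb : 0 < b) :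
    ‖(Real.pi / b : ℂ) ^ (1 / 2 : ℂ)‖ₑ = ENNReal.ofReal (√(Real.pi / b)) := by
  rw [← ofReal_norm, show (Real.pi / b : ℂ) = ((Real.pi / b : ℝ) : ℂ) by push_cast; rfl,
    Complex.norm_cpow_eq_rpow_re_of_pos (by positivity), Real.sqrt_eq_rpow]
  norm_num

lemma enorm_cexp_ofReal (x : ℝ) : ‖Complex.exp x‖ₑ = ENNReal.ofReal (Real.exp x) := by
  rw [← ofReal_norm, Complex.norm_exp_ofReal]

lemma enorm_cexp_mul_I (x : ℝ) : ‖Complex.exp (x * Complex.I)‖ₑ = 1 := by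
  rw [← ofReal_norm, Complex.norm_exp_ofReal_mul_I, ENNReal.ofReal_one]

/-- The average of the square of the Fourier transform of a Frostman measure. -/
lemma exists_lintegral_charFun_sq_le : ∃ G : ℝ≥0, ∀ (μ : Measure ℝ) [IsFiniteMeasure μ] (s C : ℝ),
    0 ≤ C → FrostmanBound μ s C → ∀ R : ℝ, 0 < R →
      ∫⁻ u, ENNReal.ofReal (Real.exp (-(u / R) ^ 2)) * ‖charFun μ u‖ₑ ^ 2 ≤
        G * ENNReal.ofReal (C * R ^ (1 - s)) * μ univ := by
  obtain ⟨G, hG⟩ := exists_lintegral_gaussian_le (κ := 1 / 4) (by norm_num)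
  refine ⟨(√Real.pi).toNNReal * G, fun μ _ s C hC hμ R hR => ?_⟩
  -- The transform of the law of a difference is the squared modulus, so Gaussian smoothing at
  -- frequency 0 turns the average into a double integral of a Gaussian of width comparable to 1/R.
  set lam : Measure ℝ := μ ∗ (μ.map (fun x => -x)) with hlam
  have hchar : ∀ u, charFun lam u = ((‖charFun μ u‖ ^ 2 : ℝ) : ℂ) := fun u => by
    rw [hlam, charFun_conv]
    have : charFun (μ.map (fun x => -x)) u = charFun μ (-u) := by
      have := charFun_map_mul (μ := μ) (-1) u
      simpa using this
    rw [this, charFun_neg, Complex.mul_conj, Complex.normSq_eq_norm_sq]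
  have hb : (0 : ℝ) < 1 / R ^ 2 := by positivity
  have key := integral_gaussian_mul_charFun lam hb 0
  have hreal : ∀ u : ℝ, Complex.exp (-((1 / R ^ 2 : ℝ) : ℂ) * ((u : ℂ) - (0 : ℝ)) ^ 2) * charFun lam u
      = ((Real.exp (-(u / R) ^ 2) * ‖charFun μ u‖ ^ 2 : ℝ) : ℂ) := fun u => by
    rw [hchar]
    push_cast
    congr 2
    rw [sub_zero]
    field_simp
  simp_rw [hreal] at key
  rw [integral_complex_ofReal] at key
  have hint : Integrable (fun u : ℝ => Real.exp (-(u / R) ^ 2) * ‖charFun μ u‖ ^ 2) := by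
    refine Integrable.mul_bdd (c := μ.real univ ^ 2) ?_ ?_ ?_
    · have := integrable_exp_neg_mul_sq hb
      refine this.congr (Eventually.of_forall fun u => ?_)
      dsimp only
      congr 1
      field_simp
    · exact (measurable_charFun.norm.pow_const 2).aestronglyMeasurable
    · refine Eventually.of_forall fun u => ?_
      rw [norm_pow, norm_norm]
      exact pow_le_pow_left₀ (norm_nonneg _) (norm_charFun_le u) 2
  have hnn : ∀ u : ℝ, 0 ≤ Real.exp (-(u / R) ^ 2) * ‖charFun μ u‖ ^ 2 := fun u => by positivity
  calc ∫⁻ u, ENNReal.ofReal (Real.exp (-(u / R) ^ 2)) * ‖charFun μ u‖ₑ ^ 2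
      = ∫⁻ u, ENNReal.ofReal (Real.exp (-(u / R) ^ 2) * ‖charFun μ u‖ ^ 2) := by
        refine lintegral_congr fun u => ?_
        rw [ENNReal.ofReal_mul (Real.exp_nonneg _), ENNReal.ofReal_pow (norm_nonneg _), ofReal_norm]
    _ = ‖((∫ u, Real.exp (-(u / R) ^ 2) * ‖charFun μ u‖ ^ 2 : ℝ) : ℂ)‖ₑ := by
        rw [← ofReal_integral_eq_lintegral_ofReal hint (Eventually.of_forall hnn), ← ofReal_norm,
          Complex.norm_of_nonneg (integral_nonneg hnn)]
    _ ≤ ∫⁻ x, ENNReal.ofReal (√Real.pi * R) * ENNReal.ofReal (Real.exp (-(1 / 4) * (R * x) ^ 2)) ∂lam := by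
        rw [key]
        refine (enorm_integral_le_lintegral_enorm _).trans (lintegral_mono fun x => ?_)
        dsimp only
        rw [enorm_mul, enorm_mul, enorm_sqrt_pi_div hb, ← Complex.ofReal_mul, enorm_cexp_mul_I, one_mul,
          show -(x : ℂ) ^ 2 / (4 * ((1 / R ^ 2 : ℝ) : ℂ)) = ((-(1 / 4) * (R * x) ^ 2 : ℝ) : ℂ) by
            push_cast; field_simp, enorm_cexp_ofReal]
        rw [div_div_eq_mul_div, div_one, Real.sqrt_mul Real.pi_pos.le, Real.sqrt_sq hR.le]
    _ = ENNReal.ofReal (√Real.pi * R) * ∫⁻ y, ∫⁻ x, ENNReal.ofReal (Real.exp (-(1 / 4) * (R * (x - y)) ^ 2)) ∂μ ∂μ := by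
        rw [lintegral_const_mul _ (by fun_prop), hlam, Measure.conv_comm]
        rw [Measure.lintegral_conv (by fun_prop), lintegral_map (by fun_prop) (by fun_prop)]
        simp_rw [neg_add_eq_sub]
    _ ≤ ENNReal.ofReal (√Real.pi * R) * ∫⁻ _, G * ENNReal.ofReal (C * R ^ (-s)) ∂μ := by
        gcongr with y
        exact hG μ s C hC hμ R hR y
    _ = _ := by
        have : ENNReal.ofReal (√Real.pi * R) * ENNReal.ofReal (C * R ^ (-s)) =
            ENNReal.ofReal √Real.pi * ENNReal.ofReal (C * R ^ (1 - s)) := by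
          rw [← ENNReal.ofReal_mul (by positivity), ← ENNReal.ofReal_mul (by positivity),
            sub_eq_add_neg, Real.rpow_add hR, Real.rpow_one]
          ring_nf
        rw [lintegral_const, ← mul_assoc, mul_left_comm, this, ENNReal.coe_mul, ← ENNReal.ofReal]
        ring

/-- The measure `exp (-x²) dμ`. Its Fourier transform is locally almost constant at scale one. -/
noncomputable def gaussWeighted (μ : Measure ℝ) : Measure ℝ :=
  μ.withDensity fun x => ENNReal.ofReal (Real.exp (-x ^ 2))

lemma gaussWeighted_le (μ : Measure ℝ) : gaussWeighted μ ≤ μ := by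
  calc gaussWeighted μ ≤ μ.withDensity 1 := withDensity_mono (Eventually.of_forall fun x => by
        simp [Real.exp_le_one_iff, sq_nonneg])
    _ = μ := withDensity_one

instance (μ : Measure ℝ) [IsFiniteMeasure μ] : IsFiniteMeasure (gaussWeighted μ) :=
  isFiniteMeasure_of_le μ (gaussWeighted_le μ)

lemma gaussWeighted_ne_zero {μ : Measure ℝ} (h : μ ≠ 0) : gaussWeighted μ ≠ 0 := by
  intro h0
  rw [gaussWeighted, withDensity_eq_zero_iff (by fun_prop)] at h0
  refine h (ae_eq_bot.1 (eventually_false_iff_eq_bot.1 ?_))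
  filter_upwards [h0] with x hx
  have : 0 < ENNReal.ofReal (Real.exp (-x ^ 2)) := ENNReal.ofReal_pos.2 (Real.exp_pos _)
  rw [hx] at this
  exact lt_irrefl _ this

lemma charFun_gaussWeighted (μ : Measure ℝ) (v : ℝ) :
    charFun (gaussWeighted μ) v =
      ∫ x : ℝ, Complex.exp (v * x * Complex.I) * Complex.exp (-(x : ℂ) ^ 2) ∂μ := by
  rw [charFun_apply_real, gaussWeighted, integral_withDensity_eq_integral_toReal_smul
    (by fun_prop) (by simp)]
  refine integral_congr_ae (Eventually.of_forall fun x => ?_)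
  dsimp only
  rw [ENNReal.toReal_ofReal (Real.exp_nonneg _), Complex.real_smul, mul_comm]
  push_cast
  rfl

lemma lintegral_gaussian_sub {b : ℝ} (hb : 0 < b) (v : ℝ) :
    ∫⁻ u, ENNReal.ofReal (Real.exp (-b * (u - v) ^ 2)) = ENNReal.ofReal (√(Real.pi / b)) := by
  rw [lintegral_sub_right_eq_self (fun u => ENNReal.ofReal (Real.exp (-b * u ^ 2))) v,
    ← integral_gaussian, ofReal_integral_eq_lintegral_ofReal (integrable_exp_neg_mul_sq hb)
      (Eventually.of_forall fun x => Real.exp_nonneg _)]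

/-- The uncertainty principle for `gaussWeighted μ`. -/
lemma enorm_charFun_gaussWeighted_sq_le (μ : Measure ℝ) [IsFiniteMeasure μ] (v : ℝ) :
    ‖charFun (gaussWeighted μ) v‖ₑ ^ 2 ≤ ENNReal.ofReal (√(Real.pi / (1 / 4))) *
      ∫⁻ u, ENNReal.ofReal (Real.exp (-(1 / 4) * (u - v) ^ 2)) * ‖charFun μ u‖ₑ ^ 2 := by
  have hb : (0 : ℝ) < 1 / 4 := by norm_num
  have key := integral_gaussian_mul_charFun μ hb v
  have h1 : ∀ x : ℝ, Complex.exp (-(x : ℂ) ^ 2 / (4 * ((1 / 4 : ℝ) : ℂ))) =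
      Complex.exp (-(x : ℂ) ^ 2) := fun x => by
    push_cast
    norm_num
  simp_rw [h1] at key
  rw [integral_const_mul, ← charFun_gaussWeighted] at key
  have hone : 1 ≤ ENNReal.ofReal (√(Real.pi / (1 / 4))) := by
    rw [ENNReal.one_le_ofReal, Real.one_le_sqrt]
    linarith [Real.pi_gt_three]
  -- The Gaussian is split into two equal factors so that Cauchy-Schwarz leaves a finite Gaussian
  -- integral and a Gaussian average of the square.
  have hle : ‖charFun (gaussWeighted μ) v‖ₑ ≤
      ∫⁻ u, ENNReal.ofReal (Real.exp (-(1 / 8) * (u - v) ^ 2)) *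
        (ENNReal.ofReal (Real.exp (-(1 / 8) * (u - v) ^ 2)) * ‖charFun μ u‖ₑ) := by
    calc ‖charFun (gaussWeighted μ) v‖ₑ
        ≤ ENNReal.ofReal (√(Real.pi / (1 / 4))) * ‖charFun (gaussWeighted μ) v‖ₑ :=
          le_mul_of_one_le_left bot_le hone
      _ = ‖∫ u : ℝ, Complex.exp (-((1 / 4 : ℝ) : ℂ) * (u - v) ^ 2) * charFun μ u‖ₑ := by
          rw [key, enorm_mul, enorm_sqrt_pi_div hb]
      _ ≤ ∫⁻ u : ℝ, ‖Complex.exp (-((1 / 4 : ℝ) : ℂ) * (u - v) ^ 2) * charFun μ u‖ₑ :=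
          enorm_integral_le_lintegral_enorm _
      _ = _ := by
          refine lintegral_congr fun u => ?_
          rw [enorm_mul, ← mul_assoc, ← ENNReal.ofReal_mul (Real.exp_nonneg _), ← Real.exp_add,
            ← enorm_cexp_ofReal]
          congr 3
          push_cast
          ring
  have hm : Measurable fun u => ENNReal.ofReal (Real.exp (-(1 / 8) * (u - v) ^ 2)) := by fun_prop
  calc ‖charFun (gaussWeighted μ) v‖ₑ ^ 2 ≤ _ := pow_le_pow_left₀ bot_le hle 2
    _ ≤ _ := lintegral_mul_sq_le volume hm.aemeasurable
        (hm.mul measurable_charFun.enorm).aemeasurable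
    _ = _ := by
      have h8 : ∀ u : ℝ, ENNReal.ofReal (Real.exp (-(1 / 8) * (u - v) ^ 2)) ^ 2 =
          ENNReal.ofReal (Real.exp (-(1 / 4) * (u - v) ^ 2)) := fun u => by
        rw [← ENNReal.ofReal_pow (Real.exp_nonneg _), ← Real.exp_nat_mul]
        congr 2
        push_cast
        ring
      simp_rw [mul_pow, h8]
      rw [lintegral_gaussian_sub hb]

/-- The uncertainty principle replaces the value at aξ by an average over u near aξ. Integrating in
a first gains |ξ|^(-α); what remains is the mean square of the transform of `μB` at scale |ξ|, which
is |ξ|^(1-β). -/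
lemma exists_lintegral_charFun_gaussWeighted_sq_le {μA μB : Measure ℝ} [IsFiniteMeasure μA]
    [IsFiniteMeasure μB] {α β CA CB M : ℝ} (hCA : 0 ≤ CA) (hCB : 0 ≤ CB)
    (hA : FrostmanBound μA α CA) (hB : FrostmanBound μB β CB) (hM : ∀ᵐ a ∂μA, |a| ≤ M) :
    ∃ D : ℝ≥0, ∀ ξ : ℝ, 1 ≤ |ξ| →
      ∫⁻ a, ‖charFun (gaussWeighted μB) (a * ξ)‖ₑ ^ 2 ∂μA ≤
        D * ENNReal.ofReal (|ξ| ^ (1 - α - β)) := by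
  obtain ⟨G₁, hG₁⟩ := exists_lintegral_gaussian_le (κ := 1 / 8) (by norm_num)
  obtain ⟨G₂, hG₂⟩ := exists_lintegral_charFun_sq_le
  set Γ := ENNReal.ofReal (√(Real.pi / (1 / 4)))
  have hfin : Γ * (ENNReal.ofReal (Real.exp (M ^ 2 / 8)) * (G₁ * (ENNReal.ofReal CA *
      (G₂ * ENNReal.ofReal (CB * 4 ^ (1 - β)) * μB univ)))) ≠ ∞ := by finiteness
  refine ⟨_, fun ξ hξ => le_of_le_of_eq ?_ (congrArg (· * _) (ENNReal.coe_toNNReal hfin).symm)⟩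
  have hξ0 : 0 < |ξ| := by linarith
  have hξ1 : ξ ≠ 0 := abs_pos.1 hξ0
  -- Half of the exponent localises a within about 1/|ξ| of u/ξ. Since |a| ≤ M and |ξ| ≥ 1, the
  -- other half confines u to |u| ≲ |ξ|.
  have hinner : ∀ u : ℝ, ∫⁻ a, ENNReal.ofReal (Real.exp (-(1 / 4) * (u - a * ξ) ^ 2)) ∂μA ≤
      ENNReal.ofReal (Real.exp (M ^ 2 / 8)) * (G₁ * ENNReal.ofReal (CA * |ξ| ^ (-α))) *
        ENNReal.ofReal (Real.exp (-(u / (4 * |ξ|)) ^ 2)) := by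
    intro u
    calc ∫⁻ a, ENNReal.ofReal (Real.exp (-(1 / 4) * (u - a * ξ) ^ 2)) ∂μA
        ≤ ∫⁻ a, ENNReal.ofReal (Real.exp (M ^ 2 / 8) * Real.exp (-(u / (4 * |ξ|)) ^ 2)) *
            ENNReal.ofReal (Real.exp (-(1 / 8) * (|ξ| * (a - u / ξ)) ^ 2)) ∂μA := by
          refine lintegral_mono_ae ?_
          filter_upwards [hM] with a ha
          rw [← ENNReal.ofReal_mul (by positivity), ← Real.exp_add, ← Real.exp_add]
          apply ENNReal.ofReal_le_ofReal
          apply Real.exp_le_exp.2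
          have e1 : (|ξ| * (a - u / ξ)) ^ 2 = (u - a * ξ) ^ 2 := by
            rw [mul_pow, sq_abs]
            field_simp
            ring
          have e2 : (u / (4 * |ξ|)) ^ 2 = (u / ξ) ^ 2 / 16 := by
            rw [div_pow, mul_pow, sq_abs, div_pow, div_div]
            ring
          have e3 : (u / ξ) ^ 2 ≤ 2 * (u - a * ξ) ^ 2 + 2 * M ^ 2 := by
            have : u / ξ = (u - a * ξ) / ξ + a := by field_simp; ring
            have h1 : ((u - a * ξ) / ξ) ^ 2 ≤ (u - a * ξ) ^ 2 := by
              rw [div_pow]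
              refine div_le_self (sq_nonneg _) ?_
              rw [← sq_abs]
              nlinarith
            have h2 : a ^ 2 ≤ M ^ 2 := sq_le_sq' (by linarith [(abs_le.1 ha).1]) (abs_le.1 ha).2
            rw [this]
            nlinarith [sq_nonneg ((u - a * ξ) / ξ - a)]
          rw [e1, e2]
          linarith
      _ ≤ ENNReal.ofReal (Real.exp (M ^ 2 / 8) * Real.exp (-(u / (4 * |ξ|)) ^ 2)) *
            (G₁ * ENNReal.ofReal (CA * |ξ| ^ (-α))) := by
          rw [lintegral_const_mul _ (by fun_prop)]
          gcongr
          exact hG₁ μA α CA hCA hA |ξ| hξ0 (u / ξ)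
      _ = _ := by
          rw [ENNReal.ofReal_mul (Real.exp_nonneg _)]
          ring
  calc ∫⁻ a, ‖charFun (gaussWeighted μB) (a * ξ)‖ₑ ^ 2 ∂μA
      ≤ ∫⁻ a, Γ * (∫⁻ u, ENNReal.ofReal (Real.exp (-(1 / 4) * (u - a * ξ) ^ 2)) *
          ‖charFun μB u‖ₑ ^ 2) ∂μA :=
        lintegral_mono fun a => enorm_charFun_gaussWeighted_sq_le μB (a * ξ)
    _ = Γ * ∫⁻ u, (∫⁻ a, ENNReal.ofReal (Real.exp (-(1 / 4) * (u - a * ξ) ^ 2)) ∂μA) *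
          ‖charFun μB u‖ₑ ^ 2 := by
        rw [lintegral_const_mul' _ _ ENNReal.ofReal_ne_top, lintegral_lintegral_swap]
        · congr 1
          refine lintegral_congr fun u => ?_
          exact lintegral_mul_const' _ _ (by finiteness)
        · refine Measurable.aemeasurable ?_
          rw [Function.uncurry_def]
          refine Measurable.fun_mul (by fun_prop) ?_
          exact (measurable_charFun.comp measurable_snd).enorm.pow_const 2
    _ ≤ Γ * ∫⁻ u, ENNReal.ofReal (Real.exp (M ^ 2 / 8)) * (G₁ * ENNReal.ofReal (CA * |ξ| ^ (-α))) *
        (ENNReal.ofReal (Real.exp (-(u / (4 * |ξ|)) ^ 2)) * ‖charFun μB u‖ₑ ^ 2) := by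
        refine mul_le_mul_right (lintegral_mono fun u => ?_) _
        dsimp only
        rw [← mul_assoc]
        exact mul_le_mul_left (hinner u) _
    _ ≤ Γ * (ENNReal.ofReal (Real.exp (M ^ 2 / 8)) * (G₁ * ENNReal.ofReal (CA * |ξ| ^ (-α))) *
        (G₂ * ENNReal.ofReal (CB * (4 * |ξ|) ^ (1 - β)) * μB univ)) := by
        rw [lintegral_const_mul' _ _ (by finiteness)]
        gcongr
        exact hG₂ μB β CB hCB hB _ (by positivity)
    _ = _ := by
        rw [Real.mul_rpow (by norm_num) hξ0.le, ← mul_assoc CB, ENNReal.ofReal_mul hCA,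
          ENNReal.ofReal_mul (by positivity : 0 ≤ CB * 4 ^ (1 - β)),
          show 1 - α - β = -α + (1 - β) by ring, Real.rpow_add hξ0,
          ENNReal.ofReal_mul (by positivity : 0 ≤ |ξ| ^ (-α))]
        ring

/-- For fixed a, the substitution u = aξ reduces this to the mean square at scale MR. The lower
bound on |a| controls the Jacobian, so no regularity of `μA` enters. -/
lemma exists_lintegral_lintegral_charFun_sq_le {μA μC : Measure ℝ} [IsFiniteMeasure μA]
    [IsFiniteMeasure μC] {γ CC M a₀ : ℝ} (hCC : 0 ≤ CC) (hC : FrostmanBound μC γ CC)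
    (ha₀ : 0 < a₀) (hM : ∀ᵐ a ∂μA, a₀ ≤ |a| ∧ |a| ≤ M) (hM0 : 0 < M) :
    ∃ D : ℝ≥0, ∀ R : ℝ, 0 < R →
      ∫⁻ ξ, ENNReal.ofReal (Real.exp (-(ξ / R) ^ 2)) *
        ∫⁻ a, ‖charFun μC (a * ξ)‖ₑ ^ 2 ∂μA ≤ D * ENNReal.ofReal (R ^ (1 - γ)) := by
  obtain ⟨G, hG⟩ := exists_lintegral_charFun_sq_le
  have hfin : ENNReal.ofReal a₀⁻¹ * (G * ENNReal.ofReal (CC * M ^ (1 - γ)) * μC univ) * μA univ ≠ ∞ := by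
    finiteness
  refine ⟨_, fun R hR => le_of_le_of_eq ?_ (congrArg (· * _) (ENNReal.coe_toNNReal hfin).symm)⟩
  set g : ℝ → ℝ≥0∞ := fun u => ENNReal.ofReal (Real.exp (-(u / (M * R)) ^ 2)) * ‖charFun μC u‖ₑ ^ 2
  have hg : Measurable g := Measurable.fun_mul (by fun_prop) (measurable_charFun.enorm.pow_const 2)
  have hint : ∀ᵐ a ∂μA, ∫⁻ ξ, ENNReal.ofReal (Real.exp (-(ξ / R) ^ 2)) * ‖charFun μC (a * ξ)‖ₑ ^ 2 ≤
      ENNReal.ofReal a₀⁻¹ * (G * ENNReal.ofReal (CC * (M * R) ^ (1 - γ)) * μC univ) := by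
    filter_upwards [hM] with a ha
    have ha0 : a ≠ 0 := abs_pos.1 (ha₀.trans_le ha.1)
    have hscale : ∫⁻ u, g u = ENNReal.ofReal |a| * ∫⁻ ξ, g (a * ξ) := by
      conv_lhs => rw [← Real.smul_map_volume_mul_left ha0]
      rw [lintegral_smul_measure, lintegral_map hg (measurable_const_mul a), smul_eq_mul]
    calc ∫⁻ ξ, ENNReal.ofReal (Real.exp (-(ξ / R) ^ 2)) * ‖charFun μC (a * ξ)‖ₑ ^ 2
        ≤ ∫⁻ ξ, g (a * ξ) := by
          refine lintegral_mono fun ξ => mul_le_mul_left ?_ _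
          apply ENNReal.ofReal_le_ofReal
          apply Real.exp_le_exp.2
          rw [neg_le_neg_iff]
          have : a * ξ / (M * R) = (a / M) * (ξ / R) := by field_simp
          rw [this, mul_pow]
          refine mul_le_of_le_one_left (sq_nonneg _) ?_
          rw [sq_le_one_iff_abs_le_one, abs_div, abs_of_pos hM0]
          exact div_le_one_of_le₀ ha.2 hM0.le
      _ ≤ ENNReal.ofReal a₀⁻¹ * (ENNReal.ofReal |a| * ∫⁻ ξ, g (a * ξ)) := by
          rw [← mul_assoc, ← ENNReal.ofReal_mul (by positivity)]
          refine le_mul_of_one_le_left bot_le ?_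
          rw [ENNReal.one_le_ofReal, inv_mul_eq_div, one_le_div ha₀]
          exact ha.1
      _ ≤ _ := by
          rw [← hscale]
          gcongr
          exact hG μC γ CC hCC hC _ (by positivity)
  calc ∫⁻ ξ, ENNReal.ofReal (Real.exp (-(ξ / R) ^ 2)) * ∫⁻ a, ‖charFun μC (a * ξ)‖ₑ ^ 2 ∂μA
      = ∫⁻ a, (∫⁻ ξ, ENNReal.ofReal (Real.exp (-(ξ / R) ^ 2)) *
          ‖charFun μC (a * ξ)‖ₑ ^ 2) ∂μA := by
        rw [lintegral_lintegral_swap]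
        · refine lintegral_congr fun ξ => ?_
          rw [lintegral_const_mul' _ _ ENNReal.ofReal_ne_top]
        · refine Measurable.aemeasurable ?_
          rw [Function.uncurry_def]
          refine Measurable.fun_mul (by fun_prop) ?_
          exact (measurable_charFun.comp (measurable_fst.mul measurable_snd)).enorm.pow_const 2
    _ ≤ ∫⁻ _, ENNReal.ofReal a₀⁻¹ * (G * ENNReal.ofReal (CC * (M * R) ^ (1 - γ)) * μC univ) ∂μA :=
        lintegral_mono_ae hint
    _ = _ := by
        rw [lintegral_const, Real.mul_rpow hM0.le hR.le, ← mul_assoc CC,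
          ENNReal.ofReal_mul (by positivity : 0 ≤ CC * M ^ (1 - γ))]
        ring

/-! ### The law of a(b + c) has square integrable Fourier transform -/

/-- The law of `x * y` for independent `x`, `y`. -/
noncomputable def mulLaw (μ ν : Measure ℝ) : Measure ℝ :=
  (μ.prod ν).map fun p => p.1 * p.2

instance (μ ν : Measure ℝ) [IsFiniteMeasure μ] [IsFiniteMeasure ν] :
    IsFiniteMeasure (mulLaw μ ν) := by
  unfold mulLaw
  infer_instance

lemma charFun_mulLaw (μ ν : Measure ℝ) [IsFiniteMeasure μ] [IsFiniteMeasure ν] (ξ : ℝ) :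
    charFun (mulLaw μ ν) ξ = ∫ a, charFun ν (a * ξ) ∂μ := by
  rw [charFun_apply_real, mulLaw, integral_map (by fun_prop) (by fun_prop), integral_prod]
  · refine integral_congr_ae (Eventually.of_forall fun a => ?_)
    dsimp only
    rw [charFun_apply_real]
    congr 1
    ext x
    push_cast
    ring_nf
  · refine (integrable_const (1 : ℝ)).mono
      (Continuous.aestronglyMeasurable (by fun_prop)) (Eventually.of_forall fun z => ?_)
    rw [← Complex.ofReal_mul, Complex.norm_exp_ofReal_mul_I, norm_one]

lemma lintegral_charFun_mulLaw_sq_lt_top {μA μB μC : Measure ℝ} [IsFiniteMeasure μA]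
    [IsFiniteMeasure μB] [IsFiniteMeasure μC] {α β γ CA CB CC M a₀ : ℝ}
    (hCA : 0 ≤ CA) (hCB : 0 ≤ CB) (hCC : 0 ≤ CC) (hA : FrostmanBound μA α CA)
    (hB : FrostmanBound μB β CB) (hC : FrostmanBound μC γ CC)
    (ha₀ : 0 < a₀) (hM0 : 0 < M) (hM : ∀ᵐ a ∂μA, a₀ ≤ |a| ∧ |a| ≤ M)
    (hγ : γ ≤ 1) (hsum : 2 < α + β + γ) :
    ∫⁻ ξ, ‖charFun (mulLaw μA (gaussWeighted μB ∗ μC)) ξ‖ₑ ^ 2 < ∞ := by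
  obtain ⟨D₁, hD₁⟩ := exists_lintegral_charFun_gaussWeighted_sq_le hCA hCB hA hB
    (hM.mono fun a ha => ha.2)
  obtain ⟨D₂, hD₂⟩ := exists_lintegral_lintegral_charFun_sq_le hCC hC ha₀ hM hM0
  set ν := mulLaw μA (gaussWeighted μB ∗ μC)
  set J : ℝ → ℝ≥0∞ := fun ξ => ∫⁻ a, ‖charFun μC (a * ξ)‖ₑ ^ 2 ∂μA with hJ
  have hν : ∀ ξ, ‖charFun ν ξ‖ₑ ^ 2 ≤
      (∫⁻ a, ‖charFun (gaussWeighted μB) (a * ξ)‖ₑ ^ 2 ∂μA) * J ξ := fun ξ => by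
    have h1 : ‖charFun ν ξ‖ₑ ≤ ∫⁻ a, ‖charFun (gaussWeighted μB) (a * ξ)‖ₑ * ‖charFun μC (a * ξ)‖ₑ ∂μA := by
      rw [charFun_mulLaw]
      refine (enorm_integral_le_lintegral_enorm _).trans (le_of_eq (lintegral_congr fun a => ?_))
      rw [charFun_conv, enorm_mul]
    refine (pow_le_pow_left₀ bot_le h1 2).trans (lintegral_mul_sq_le μA ?_ ?_)
    · exact (measurable_charFun.comp (measurable_mul_const ξ)).enorm.aemeasurable
    · exact (measurable_charFun.comp (measurable_mul_const ξ)).enorm.aemeasurable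
  set S : ℕ → Set ℝ := fun n => {ξ | 2 ^ n ≤ |ξ| ∧ |ξ| < 2 ^ (n + 1)} with hS
  have hSm : ∀ n, MeasurableSet (S n) := fun n =>
    (measurableSet_le measurable_const measurable_abs).inter
      (measurableSet_lt measurable_abs measurable_const)
  set r : ℝ := 2 ^ (2 - α - β - γ) with hr
  have hr0 : 0 < r := by positivity
  have hr1 : r < 1 := Real.rpow_lt_one_of_one_lt_of_neg (by norm_num) (by linarith)
  -- On the shell the Gaussian at scale 2^(n+1) is at least 1/e, so the averaged bound for the C
  -- factor applies.
  have hshell : ∀ n, ∫⁻ ξ in S n, ‖charFun ν ξ‖ₑ ^ 2 ≤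
      D₁ * ENNReal.ofReal (Real.exp 1) * D₂ * ENNReal.ofReal (2 ^ (1 - γ)) * ENNReal.ofReal (r ^ n) := by
    intro n
    have h2n : (0 : ℝ) < 2 ^ n := by positivity
    calc ∫⁻ ξ in S n, ‖charFun ν ξ‖ₑ ^ 2
        ≤ ∫⁻ ξ in S n, D₁ * ENNReal.ofReal ((2 ^ n) ^ (1 - α - β)) * (ENNReal.ofReal (Real.exp 1) *
            (ENNReal.ofReal (Real.exp (-(ξ / 2 ^ (n + 1)) ^ 2)) * J ξ)) := by
          refine setLIntegral_mono' (hSm n) fun ξ hξ => (hν ξ).trans ?_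
          have h1 : (1 : ℝ) ≤ |ξ| := (one_le_pow₀ (by norm_num)).trans hξ.1
          refine mul_le_mul' ((hD₁ ξ h1).trans ?_) ?_
          · gcongr 1
            apply ENNReal.ofReal_le_ofReal
            -- The exponent 1 - α - β is negative because γ ≤ 1 and the sum exceeds 2.
            exact Real.rpow_le_rpow_of_nonpos h2n hξ.1 (by linarith)
          · rw [← mul_assoc, ← ENNReal.ofReal_mul (Real.exp_nonneg _), ← Real.exp_add]
            refine le_mul_of_one_le_left bot_le ?_
            rw [ENNReal.one_le_ofReal, Real.one_le_exp_iff]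
            have : (ξ / 2 ^ (n + 1)) ^ 2 ≤ 1 := by
              rw [sq_le_one_iff_abs_le_one, abs_div, abs_of_pos (by positivity : (0 : ℝ) < 2 ^ (n + 1))]
              exact div_le_one_of_le₀ hξ.2.le (by positivity)
            linarith
      _ ≤ D₁ * ENNReal.ofReal ((2 ^ n) ^ (1 - α - β)) * (ENNReal.ofReal (Real.exp 1) *
            (D₂ * ENNReal.ofReal ((2 ^ (n + 1)) ^ (1 - γ)))) := by
          refine (setLIntegral_le_lintegral _ _).trans ?_
          rw [lintegral_const_mul' _ _ (by finiteness), lintegral_const_mul' _ _ (by finiteness)]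
          gcongr
          exact hD₂ _ (by positivity)
      _ = _ := by
          have e : r ^ n = (2 ^ n : ℝ) ^ (1 - α - β) * (2 ^ n) ^ (1 - γ) := by
            rw [← Real.rpow_add h2n, hr, ← Real.rpow_natCast, ← Real.rpow_natCast,
              ← Real.rpow_mul (by norm_num), ← Real.rpow_mul (by norm_num)]
            ring_nf
          rw [e, pow_succ, Real.mul_rpow h2n.le (by norm_num), ENNReal.ofReal_mul (by positivity),
            ENNReal.ofReal_mul (by positivity)]
          ring
  have hcov : (univ : Set ℝ) ⊆ Icc (-1) 1 ∪ ⋃ n, S n := fun ξ _ => by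
    rcases le_or_gt |ξ| 1 with h | h
    · exact Or.inl (abs_le.1 h)
    · obtain ⟨n, hn⟩ := exists_nat_pow_near h.le (by norm_num : (1 : ℝ) < 2)
      exact Or.inr (mem_iUnion.2 ⟨n, hn⟩)
  calc ∫⁻ ξ, ‖charFun ν ξ‖ₑ ^ 2 = ∫⁻ ξ in univ, ‖charFun ν ξ‖ₑ ^ 2 := by simp
    _ ≤ ∫⁻ ξ in Icc (-1) 1 ∪ ⋃ n, S n, ‖charFun ν ξ‖ₑ ^ 2 := lintegral_mono_set hcov
    _ ≤ (∫⁻ ξ in Icc (-1) 1, ‖charFun ν ξ‖ₑ ^ 2) + ∫⁻ ξ in ⋃ n, S n, ‖charFun ν ξ‖ₑ ^ 2 :=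
        lintegral_union_le _ _ _
    _ ≤ (∫⁻ ξ in Icc (-1 : ℝ) 1, (ν univ) ^ 2) + ∑' n, ∫⁻ ξ in S n, ‖charFun ν ξ‖ₑ ^ 2 := by
        refine add_le_add (lintegral_mono fun ξ => pow_le_pow_left₀ bot_le ?_ 2)
          (lintegral_iUnion_le _ _)
        rw [← ofReal_norm, ← ofReal_measureReal (μ := ν) (s := univ)]
        exact ENNReal.ofReal_le_ofReal (norm_charFun_le ξ)
    _ ≤ (ν univ) ^ 2 * volume (Icc (-1 : ℝ) 1) + ∑' n, D₁ * ENNReal.ofReal (Real.exp 1) * D₂ *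
          ENNReal.ofReal (2 ^ (1 - γ)) * ENNReal.ofReal (r ^ n) := by
        rw [setLIntegral_const]
        exact add_le_add le_rfl (ENNReal.tsum_le_tsum hshell)
    _ < ∞ := by
        rw [ENNReal.tsum_mul_left, ← ENNReal.ofReal_tsum_of_nonneg (fun n => by positivity)
          (summable_geometric_of_lt_one hr0.le hr1), Real.volume_Icc]
        finiteness

/-! ### Square integrable Fourier transform and null compacta -/

open scoped FourierTransform SchwartzMap ContDiff in
lemma SchwartzMap.lintegral_enorm_fourier_sq (f : 𝓢(ℝ, ℂ)) :
    ∫⁻ ξ, ‖𝓕 f ξ‖ₑ ^ 2 = ∫⁻ x, ‖f x‖ₑ ^ 2 := by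
  have h : ∀ g : 𝓢(ℝ, ℂ), ∫⁻ x, ‖g x‖ₑ ^ 2 = ENNReal.ofReal (∫ x, ‖g x‖ ^ 2) := fun g => by
    rw [ofReal_integral_eq_lintegral_ofReal (μ := volume) (f := fun x => ‖g x‖ ^ 2)
      ((memLp_two_iff_integrable_sq_norm g.continuous.aestronglyMeasurable).1 (g.memLp 2))
      (Eventually.of_forall fun x => by positivity)]
    refine lintegral_congr fun x => ?_
    rw [ENNReal.ofReal_pow (norm_nonneg _), ofReal_norm]
  rw [h, h, SchwartzMap.integral_norm_sq_fourier]

-- Fourier inversion and Fubini. The factor 2π reconciles the normalisation of `𝓕` with that of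
-- `charFun`.
open scoped FourierTransform SchwartzMap ContDiff in
lemma SchwartzMap.integral_eq_integral_fourier_mul_charFun (f : 𝓢(ℝ, ℂ)) (ν : Measure ℝ)
    [IsFiniteMeasure ν] :
    ∫ x, f x ∂ν = ∫ ξ, 𝓕 f ξ * charFun ν (2 * Real.pi * ξ) := by
  have hinv : ∀ x, f x = ∫ ξ : ℝ, Complex.exp ((2 * Real.pi * ξ : ℝ) * x * Complex.I) * 𝓕 f ξ := by
    intro x
    have h1 : 𝓕⁻ (𝓕 f) x = f x := by rw [FourierTransform.fourierInv_fourier_eq]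
    rw [← h1, SchwartzMap.fourierInv_coe, Real.fourierInv_eq']
    congr 1
    ext ξ
    rw [smul_eq_mul, RCLike.inner_apply, conj_trivial]
    congr 2
    push_cast
    ring
  simp_rw [charFun_apply_real, ← integral_const_mul]
  conv_lhs => rw [integral_congr_ae (Eventually.of_forall hinv)]
  rw [integral_integral_swap]
  · congr 1
    ext ξ
    congr 1
    ext x
    rw [mul_comm]
  · refine ((𝓕 f).integrable.comp_snd ν).mono ?_ (Eventually.of_forall fun z => ?_)
    · refine Continuous.aestronglyMeasurable ?_
      rw [Function.uncurry_def]
      have := (𝓕 f).continuous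
      fun_prop
    · rw [Function.uncurry_def]
      dsimp only
      rw [norm_mul, ← Complex.ofReal_mul, Complex.norm_exp_ofReal_mul_I, one_mul]

open scoped ContDiff Manifold in
lemma exists_contDiff_one_on_isCompact {T U : Set ℝ} (hT : IsCompact T) (hU : IsOpen U)
    (hTU : T ⊆ U) : ∃ f : ℝ → ℝ, ContDiff ℝ ∞ f ∧ HasCompactSupport f ∧ (∀ x, 0 ≤ f x) ∧
      (∀ x, f x ≤ U.indicator 1 x) ∧ ∀ x ∈ T, f x = 1 := by
  -- Intersecting with a bounded neighbourhood of `T` makes the support compact.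
  obtain ⟨f, hf, hrange, hsupp, hone⟩ := exists_contMDiff_support_eq_eq_one_iff (n := (⊤ : ℕ∞)) 𝓘(ℝ, ℝ)
    (hU.inter (Metric.isOpen_thickening (δ := 1) (E := T))) hT.isClosed
    (subset_inter hTU (Metric.self_subset_thickening one_pos T))
  refine ⟨f, hf.contDiff, ?_, fun x => (hrange ⟨x, rfl⟩).1, fun x => ?_,
    fun x hx => (hone x).1 hx⟩
  · refine HasCompactSupport.of_support_subset_isCompact
      (hT.isBounded.cthickening (δ := 1)).isCompact_closure ?_
    rw [hsupp]
    exact (inter_subset_right.trans (Metric.thickening_subset_cthickening 1 T)).trans subset_closure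
  · by_cases hx : x ∈ U
    · simpa [hx] using (hrange ⟨x, rfl⟩).2
    · have : x ∉ Function.support f := by
        rw [hsupp]
        exact fun h => hx h.1
      simp [hx, Function.notMem_support.1 this]

open scoped FourierTransform SchwartzMap ContDiff in
/-- A finite measure with square integrable Fourier transform gives no mass to null compacta. -/
lemma measure_eq_zero_of_lintegral_charFun_sq_lt_top {ν : Measure ℝ} [IsFiniteMeasure ν]
    (hν : ∫⁻ ξ, ‖charFun ν ξ‖ₑ ^ 2 < ⊤) {T : Set ℝ} (hT : IsCompact T) (h0 : volume T = 0) :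
    ν T = 0 := by
  set I := ∫⁻ ξ, ‖charFun ν (2 * Real.pi * ξ)‖ₑ ^ 2 with hI
  have hIfin : I ≠ ⊤ := by
    have h2 : (2 * Real.pi) ≠ 0 := by positivity
    have hm : Measurable fun u => ‖charFun ν u‖ₑ ^ 2 := measurable_charFun.enorm.pow_const 2
    have hscale : ∫⁻ u, ‖charFun ν u‖ₑ ^ 2 = ENNReal.ofReal |2 * Real.pi| * I := by
      conv_lhs => rw [← Real.smul_map_volume_mul_left h2]
      rw [lintegral_smul_measure, lintegral_map hm (measurable_const_mul _), smul_eq_mul]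
    intro htop
    rw [hscale, htop, ENNReal.mul_top (by simp [Real.pi_ne_zero])] at hν
    exact lt_irrefl _ hν
  -- Test against a bump between the indicators of `T` and of an open set of measure below ε; by
  -- Plancherel the square of its L² norm is at most ε.
  have key : ∀ ε : ℝ≥0, 0 < ε → ν T ^ 2 ≤ ε * I := by
    intro ε hε
    obtain ⟨U, hTU, hU, hUε⟩ := T.exists_isOpen_lt_of_lt (μ := volume) ε
      (by rw [h0]; exact_mod_cast hε)
    obtain ⟨f, hf, hfc, hf0, hfU, hf1⟩ := exists_contDiff_one_on_isCompact hT hU hTU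
    have hc : HasCompactSupport (Complex.ofRealCLM ∘ f) := hfc.comp_left rfl
    set g : 𝓢(ℝ, ℂ) := hc.toSchwartzMap (Complex.ofRealCLM.contDiff.comp hf) with hg
    have hgf : ∀ x, g x = (f x : ℂ) := fun x => rfl
    have hle : ν T ≤ ∫⁻ ξ, ‖𝓕 g ξ‖ₑ * ‖charFun ν (2 * Real.pi * ξ)‖ₑ := by
      calc ν T = ∫⁻ x, T.indicator 1 x ∂ν := (lintegral_indicator_one hT.measurableSet).symm
        _ ≤ ∫⁻ x, ENNReal.ofReal (f x) ∂ν := by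
            refine lintegral_mono fun x => ?_
            by_cases hx : x ∈ T
            · simp [hx, hf1 x hx]
            · simp [hx]
        _ = ‖∫ x, g x ∂ν‖ₑ := by
            simp_rw [hgf]
            rw [integral_complex_ofReal, ← ofReal_norm,
              Complex.norm_of_nonneg (integral_nonneg hf0),
              ofReal_integral_eq_lintegral_ofReal (hf.continuous.integrable_of_hasCompactSupport hfc)
                (Eventually.of_forall hf0)]
        _ ≤ _ := by
            rw [g.integral_eq_integral_fourier_mul_charFun ν]
            refine (enorm_integral_le_lintegral_enorm _).trans (le_of_eq ?_)
            simp_rw [enorm_mul]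
    calc ν T ^ 2 ≤ _ := pow_le_pow_left₀ bot_le hle 2
      _ ≤ (∫⁻ ξ, ‖𝓕 g ξ‖ₑ ^ 2) * I := lintegral_mul_sq_le volume
          (𝓕 g).continuous.measurable.enorm.aemeasurable
          (measurable_charFun.comp (measurable_const_mul _)).enorm.aemeasurable
      _ ≤ ε * I := by
          rw [SchwartzMap.lintegral_enorm_fourier_sq]
          gcongr
          calc ∫⁻ x, ‖g x‖ₑ ^ 2 ≤ ∫⁻ x, U.indicator 1 x := by
                refine lintegral_mono fun x => ?_
                have h1 := hfU x
                have h2 := hf0 x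
                rw [hgf, ← ofReal_norm, Complex.norm_of_nonneg h2, ← ENNReal.ofReal_pow h2]
                by_cases hx : x ∈ U
                · simp only [hx, indicator_of_mem, Pi.one_apply] at h1 ⊢
                  exact ENNReal.ofReal_le_one.2 (pow_le_one₀ h2 h1)
                · simp only [hx, not_false_eq_true, indicator_of_notMem] at h1 ⊢
                  rw [le_antisymm h1 h2]
                  simp
            _ = volume U := lintegral_indicator_one hU.measurableSet
            _ ≤ ε := hUε.le
  by_contra hne
  have hIr : I ≤ (I.toNNReal + 1 : ℝ≥0) := by
    rw [ENNReal.coe_add, ENNReal.coe_toNNReal hIfin]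
    exact le_self_add
  have hfin : ν T ^ 2 ≠ ⊤ := by finiteness
  have hpos : 0 < (ν T ^ 2).toNNReal := ENNReal.toNNReal_pos (pow_ne_zero 2 hne) hfin
  -- This ε makes the bound at most half of ν(T)²; the added 1 guards against I = 0.
  have h1 := key ((ν T ^ 2).toNNReal / 2 / (I.toNNReal + 1)) (by positivity)
  have h2 : ν T ^ 2 ≤ (((ν T ^ 2).toNNReal / 2 : ℝ≥0) : ℝ≥0∞) := by
    refine h1.trans ((mul_le_mul_right hIr _).trans (le_of_eq ?_))
    rw [← ENNReal.coe_mul, div_mul_cancel₀ _ (by positivity)]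
  rw [← ENNReal.coe_toNNReal hfin, ENNReal.coe_le_coe, ENNReal.toNNReal_coe] at h2
  exact absurd h2 (not_le.2 (NNReal.half_lt_self hpos.ne'))

/-! ### Positive measure of A(B + C) -/

lemma exists_lt_sum_of_lt {x y z : ℝ≥0∞} (hx : x ≤ 1) (hy : y ≤ 1) (hz : z ≤ 1)
    (h : 2 < x + y + z) : ∃ α β γ : ℝ≥0, 0 < α ∧ 0 < β ∧ 0 < γ ∧ (α : ℝ≥0∞) < x ∧
      (β : ℝ≥0∞) < y ∧ (γ : ℝ≥0∞) < z ∧ (2 : ℝ) < α + β + γ := by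
  lift x to ℝ≥0 using ne_top_of_le_ne_top ENNReal.one_ne_top hx
  lift y to ℝ≥0 using ne_top_of_le_ne_top ENNReal.one_ne_top hy
  lift z to ℝ≥0 using ne_top_of_le_ne_top ENNReal.one_ne_top hz
  have hx' : (x : ℝ) ≤ 1 := by exact_mod_cast hx
  have hy' : (y : ℝ) ≤ 1 := by exact_mod_cast hy
  have hz' : (z : ℝ) ≤ 1 := by exact_mod_cast hz
  have h' : (2 : ℝ) < x + y + z := by exact_mod_cast h
  -- Three decrements use up three quarters of the excess. Each number is at least 4ε, since the
  -- other two are at most 1.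
  set ε : ℝ := (x + y + z - 2) / 4 with hε
  have hex : ∀ w : ℝ≥0, ε < w → ∃ a : ℝ≥0, 0 < a ∧ (a : ℝ≥0∞) < w ∧ (a : ℝ) = w - ε := by
    intro w hw
    refine ⟨(w - ε).toNNReal, by simpa using hw, ?_, Real.coe_toNNReal _ (by linarith)⟩
    rw [ENNReal.coe_lt_coe, ← NNReal.coe_lt_coe, Real.coe_toNNReal _ (by linarith)]
    linarith
  obtain ⟨α, hα0, hαx, hα⟩ := hex x (by linarith)
  obtain ⟨β, hβ0, hβy, hβ⟩ := hex y (by linarith)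
  obtain ⟨γ, hγ0, hγz, hγ⟩ := hex z (by linarith)
  exact ⟨α, β, γ, hα0, hβ0, hγ0, hαx, hβy, hγz, by linarith⟩

/-- Borel sets `A`, `B`, `C` with `dim A + dim B + dim C > 2` have `|A (B + C)| > 0`. -/
theorem volume_mul_add_pos {A B C : Set ℝ} (hA : MeasurableSet A) (hB : MeasurableSet B)
    (hC : MeasurableSet C) (h : 2 < dimH A + dimH B + dimH C) : 0 < volume (A * (B + C)) := by
  have hle : ∀ E : Set ℝ, dimH E ≤ 1 := fun E => (dimH_mono (subset_univ E)).trans Real.dimH_univ.le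
  obtain ⟨α, β, γ, hα, hβ, hγ, hαA, hβB, hγC, hsum⟩ := exists_lt_sum_of_lt (hle A) (hle B) (hle C) h
  have hγ1 : (γ : ℝ) ≤ 1 := by exact_mod_cast (hγC.trans_le (hle C)).le
  -- Removing 0 does not affect the dimension and keeps the compact set `KA` away from 0, as the
  -- substitution u = aξ requires.
  have hαA' : (α : ℝ≥0∞) < dimH (A \ {0}) := by
    have h1 : dimH A ≤ dimH ((A \ {0}) ∪ {0}) := dimH_mono (by simp)
    rw [dimH_union, dimH_singleton, max_eq_left zero_le] at h1
    exact hαA.trans_le h1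
  obtain ⟨KA, hKA, hKAc, μA, _, hμA0, hμA, CA, hCA, hFA⟩ :=
    exists_frostmanBound hα (hA.diff (measurableSet_singleton 0)) hαA'
  obtain ⟨KB, hKB, hKBc, μB, _, hμB0, hμB, CB, hCB, hFB⟩ := exists_frostmanBound hβ hB hβB
  obtain ⟨KC, hKC, hKCc, μC, _, hμC0, hμC, CC, hCC, hFC⟩ := exists_frostmanBound hγ hC hγC
  obtain ⟨M, hM0, hM⟩ : ∃ M : ℝ, 0 < M ∧ ∀ a ∈ KA, |a| ≤ M := by
    obtain ⟨M, hM0, hM⟩ := hKAc.isBounded.exists_pos_norm_le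
    exact ⟨M, hM0, hM⟩
  obtain ⟨a₀, ha₀, ha⟩ : ∃ a₀ : ℝ, 0 < a₀ ∧ ∀ a ∈ KA, a₀ ≤ |a| := by
    have h0 : (0 : ℝ) ∈ KAᶜ := fun h0 => (hKA h0).2 rfl
    obtain ⟨ε, hε, hball⟩ := Metric.isOpen_iff.1 hKAc.isClosed.isOpen_compl 0 h0
    refine ⟨ε, hε, fun a haK => not_lt.1 fun hlt => hball ?_ haK⟩
    simpa using hlt
  have haeA : ∀ᵐ a ∂μA, a ∈ KA := hμA
  have haeB : ∀ᵐ b ∂gaussWeighted μB, b ∈ KB := Measure.absolutelyContinuous_of_le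
    (gaussWeighted_le μB) hμB
  have haeC : ∀ᵐ c ∂μC, c ∈ KC := hμC
  set lam := gaussWeighted μB ∗ μC with hlam
  set ν := mulLaw μA lam with hν
  set T := KA * (KB + KC) with hT
  have hTc : IsCompact T := hKAc.mul (hKBc.add hKCc)
  have hL2 := lintegral_charFun_mulLaw_sq_lt_top hCA hCB hCC hFA hFB hFC ha₀ hM0
    (haeA.mono fun a haK => ⟨ha a haK, hM a haK⟩) hγ1 hsum
  have hlamK : ∀ᵐ x ∂lam, x ∈ KB + KC := by
    rw [hlam, Measure.conv, ae_map_iff (p := fun x => x ∈ KB + KC) (by fun_prop) (hKBc.add hKCc).measurableSet]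
    have h1 : ∀ᵐ p ∂(gaussWeighted μB).prod μC, p.1 ∈ KB := Measure.quasiMeasurePreserving_fst.ae haeB
    have h2 : ∀ᵐ p ∂(gaussWeighted μB).prod μC, p.2 ∈ KC := Measure.quasiMeasurePreserving_snd.ae haeC
    filter_upwards [h1, h2] with p hp1 hp2 using Set.add_mem_add hp1 hp2
  have hνT : ∀ᵐ x ∂ν, x ∈ T := by
    rw [hν, mulLaw, ae_map_iff (p := fun x => x ∈ T) (by fun_prop) hTc.measurableSet]
    have h1 : ∀ᵐ p ∂μA.prod lam, p.1 ∈ KA := Measure.quasiMeasurePreserving_fst.ae haeA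
    have h2 : ∀ᵐ p ∂μA.prod lam, p.2 ∈ KB + KC := Measure.quasiMeasurePreserving_snd.ae hlamK
    filter_upwards [h1, h2] with p hp1 hp2 using Set.mul_mem_mul hp1 hp2
  have hpos : volume T ≠ 0 := by
    intro h0
    have h1 : ν T = 0 := measure_eq_zero_of_lintegral_charFun_sq_lt_top hL2 hTc h0
    have h2 : ν univ = 0 := by
      rw [← union_compl_self T]
      exact measure_union_null h1 hνT
    rw [hν, mulLaw, Measure.map_apply (by fun_prop) MeasurableSet.univ, preimage_univ,
      ← univ_prod_univ, Measure.prod_prod, hlam, Measure.conv, Measure.map_apply (by fun_prop)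
      MeasurableSet.univ, preimage_univ, ← univ_prod_univ, Measure.prod_prod] at h2
    simp only [mul_eq_zero, Measure.measure_univ_eq_zero] at h2
    rcases h2 with h2 | h2 | h2
    exacts [hμA0 h2, gaussWeighted_ne_zero hμB0 h2, hμC0 h2]
  exact (pos_iff_ne_zero.2 hpos).trans_le
    (measure_mono (mul_subset_mul (hKA.trans sdiff_subset) (add_subset_add hKB hKC)))

/-! ### Sharpness: a null sumset of a set of dimension one -/

/-- A map with Hölder inverse on `s` does not decrease the dimension of `s` too much. -/
lemma dimH_le_dimH_image_div_of_edist_le {X Y : Type*} [MetricSpace X] [EMetricSpace Y]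
    {g : X → Y} {s : Set X} {C r : ℝ≥0} (hr : 0 < r)
    (h : ∀ x ∈ s, ∀ y ∈ s, edist x y ≤ C * edist (g x) (g y) ^ (r : ℝ)) :
    dimH s ≤ dimH (g '' s) / r := by
  rcases s.eq_empty_or_nonempty with rfl | ⟨x₀, hx₀⟩
  · simp
  have : Nonempty X := ⟨x₀⟩
  have hinj : InjOn g s := fun x hx y hy hxy => by
    have := h x hx y hy
    rw [hxy, edist_self, ENNReal.zero_rpow_of_pos (by exact_mod_cast hr), mul_zero] at this
    exact edist_le_zero.1 this
  have hf : HolderOnWith C r (Function.invFunOn g s) (g '' s) := by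
    rintro _ ⟨x, hx, rfl⟩ _ ⟨y, hy, rfl⟩
    rw [hinj.leftInvOn_invFunOn hx, hinj.leftInvOn_invFunOn hy]
    exact h x hx y hy
  have := hf.dimH_image_le hr
  rwa [hinj.invFunOn_image Subset.rfl] at this

namespace SparseCantor

/-- The position of the `J`-th binary digit after the insertion of sparse long blocks of zeros. -/
def pos (J : ℕ) : ℕ := J + Nat.log 2 J ^ 2

/-- The weight of the `J`-th digit. -/
noncomputable def wt (J : ℕ) : ℝ := (1 / 2) ^ pos J

/-- The binary digits of `n` spread out to the weights `wt 0, …, wt J`. -/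
noncomputable def spread : ℕ → ℤ → ℝ
  | 0, n => n
  | J + 1, n => spread J (n / 2) + (n % 2 : ℤ) * wt (J + 1)

/-- The digit spreading map. -/
noncomputable def spreadMap (x : ℝ) : ℝ := ⨆ J, spread J ⌊(2 : ℝ) ^ J * x⌋

lemma wt_pos (J : ℕ) : 0 < wt J := by unfold wt; positivity

lemma wt_zero : wt 0 = 1 := by simp [wt, pos]

lemma pos_succ (J : ℕ) : pos J + 1 ≤ pos (J + 1) := by
  have : Nat.log 2 J ^ 2 ≤ Nat.log 2 (J + 1) ^ 2 :=
    Nat.pow_le_pow_left (Nat.log_mono_right J.le_succ) 2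
  unfold pos
  omega

lemma two_mul_wt_succ_le (J : ℕ) : 2 * wt (J + 1) ≤ wt J := by
  have : wt (J + 1) ≤ (1 / 2) ^ (pos J + 1) :=
    pow_le_pow_of_le_one (by norm_num) (by norm_num) (pos_succ J)
  rw [pow_succ] at this
  unfold wt at *
  linarith

/-- Adding one either sets the last digit or carries; a carry loses `wt (J + 1)` but gains `wt J`,
at least twice as much. -/
lemma spread_add_wt_le (J : ℕ) (n : ℤ) : spread J n + wt J ≤ spread J (n + 1) := by
  induction J generalizing n with
  | zero => simp [spread, wt_zero]
  | succ J ih =>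
    have h2 := two_mul_wt_succ_le J
    simp only [spread]
    rcases Int.emod_two_eq_zero_or_one n with h | h
    · rw [show (n + 1) / 2 = n / 2 by omega, show (n + 1) % 2 = 1 by omega, h]
      push_cast
      linarith
    · have := ih (n / 2)
      rw [show (n + 1) / 2 = n / 2 + 1 by omega, show (n + 1) % 2 = 0 by omega, h]
      push_cast
      linarith

lemma spread_add_mul_wt_le (J : ℕ) (n : ℤ) (k : ℕ) :
    spread J n + k * wt J ≤ spread J (n + k) := by
  induction k with
  | zero => simp
  | succ k ih =>
    have := spread_add_wt_le J (n + k)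
    push_cast
    rw [← add_assoc]
    linarith

lemma spread_zero_right (J : ℕ) : spread J 0 = 0 := by
  induction J with
  | zero => simp [spread]
  | succ J ih => simp [spread, ih]

/-- The lattice structure is what will make sums of two truncated values no more numerous, up to a
constant, than the values themselves. -/
lemma exists_spread_eq (J : ℕ) (n : ℤ) : ∃ z : ℤ, spread J n = z * wt J := by
  induction J generalizing n with
  | zero => exact ⟨n, by simp [spread, wt_zero]⟩
  | succ J ih =>
    obtain ⟨z, hz⟩ := ih (n / 2)
    have hw : wt J = 2 ^ (pos (J + 1) - pos J) * wt (J + 1) := by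
      unfold wt
      obtain ⟨m, hm⟩ := Nat.exists_eq_add_of_le ((Nat.le_succ _).trans (pos_succ J))
      rw [hm, Nat.add_sub_cancel_left, pow_add, mul_left_comm, ← mul_pow]
      norm_num
    refine ⟨z * 2 ^ (pos (J + 1) - pos J) + n % 2, ?_⟩
    rw [spread, hz, hw]
    push_cast
    ring

lemma spread_floor_succ (J : ℕ) (x : ℝ) :
    spread (J + 1) ⌊(2 : ℝ) ^ (J + 1) * x⌋ =
      spread J ⌊(2 : ℝ) ^ J * x⌋ + (⌊(2 : ℝ) ^ (J + 1) * x⌋ % 2 : ℤ) * wt (J + 1) := by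
  have h := DyadicContent.floor_div J (J + 1) J.le_succ x
  rw [Nat.add_sub_cancel_left, pow_one] at h
  rw [spread, h]

/-- The weights at least halve at each step, so all digits beyond `J` add at most `2 * wt (J + 1)`.
The intervals are nested. -/
lemma spreadMap_mem_Icc (x : ℝ) (J : ℕ) :
    spreadMap x ∈ Icc (spread J ⌊(2 : ℝ) ^ J * x⌋)
      (spread J ⌊(2 : ℝ) ^ J * x⌋ + 2 * wt (J + 1)) := by
  have hdig : ∀ n : ℤ, (0 : ℝ) ≤ (n % 2 : ℤ) ∧ ((n % 2 : ℤ) : ℝ) ≤ 1 := fun n =>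
    ⟨by exact_mod_cast (by omega : 0 ≤ n % 2), by exact_mod_cast (by omega : n % 2 ≤ 1)⟩
  have hu : Monotone fun J => spread J ⌊(2 : ℝ) ^ J * x⌋ := monotone_nat_of_le_succ fun J => by
    rw [spread_floor_succ]
    exact le_add_of_nonneg_right (mul_nonneg (hdig _).1 (wt_pos _).le)
  have hv : Antitone fun J => spread J ⌊(2 : ℝ) ^ J * x⌋ + 2 * wt (J + 1) :=
    antitone_nat_of_succ_le fun J => by
      rw [spread_floor_succ]
      have h1 := two_mul_wt_succ_le (J + 1)
      have h2 := mul_le_of_le_one_left (wt_pos (J + 1)).le (hdig ⌊(2 : ℝ) ^ (J + 1) * x⌋).2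
      linarith
  exact mem_iInter.1 (hu.ciSup_mem_iInter_Icc_of_antitone hv fun J =>
    le_add_of_nonneg_right (mul_nonneg zero_le_two (wt_pos _).le)) J

lemma wt_le_spreadMap_sub {x y : ℝ} {J : ℕ} (h : 4 ≤ (2 : ℝ) ^ J * (y - x)) :
    wt J ≤ spreadMap y - spreadMap x := by
  have hfl : ⌊(2 : ℝ) ^ J * x⌋ + 3 ≤ ⌊(2 : ℝ) ^ J * y⌋ := by
    rw [Int.le_floor]
    push_cast
    linarith [Int.floor_le ((2 : ℝ) ^ J * x)]
  obtain ⟨k, hk⟩ := Int.le.dest hfl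
  have h1 := spread_add_mul_wt_le J ⌊(2 : ℝ) ^ J * x⌋ (3 + k)
  rw [show ⌊(2 : ℝ) ^ J * x⌋ + ((3 + k : ℕ) : ℤ) = ⌊(2 : ℝ) ^ J * y⌋ by rw [← hk]; push_cast; ring]
    at h1
  have h2 := (spreadMap_mem_Icc x J).2
  have h3 := (spreadMap_mem_Icc y J).1
  have h4 := two_mul_wt_succ_le J
  have h5 := mul_nonneg (Nat.cast_nonneg (α := ℝ) k) (wt_pos J).le
  have h6 := wt_pos J
  push_cast at h1
  linarith

/-- The inserted zeros have density zero. -/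
lemma exists_pos_le {ε : ℝ} (hε : 0 < ε) : ∃ K : ℝ, 0 ≤ K ∧ ∀ J, (pos J : ℝ) ≤ (1 + ε) * J + K := by
  have hlim := tendsto_pow_const_div_const_pow_of_one_lt 2 (one_lt_two (α := ℝ))
  obtain ⟨L₀, hL₀⟩ := eventually_atTop.1 (hlim.eventually (gt_mem_nhds hε))
  refine ⟨(L₀ : ℝ) ^ 2, by positivity, fun J => ?_⟩
  have key : ((Nat.log 2 J : ℕ) : ℝ) ^ 2 ≤ ε * J + (L₀ : ℝ) ^ 2 := by
    rcases lt_or_ge (Nat.log 2 J) L₀ with h | h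
    · have h1 : ((Nat.log 2 J : ℕ) : ℝ) ≤ L₀ := by exact_mod_cast h.le
      have h2 : ((Nat.log 2 J : ℕ) : ℝ) ^ 2 ≤ (L₀ : ℝ) ^ 2 := by gcongr
      have : 0 ≤ ε * J := by positivity
      linarith
    · rcases Nat.eq_zero_or_pos J with rfl | hJ
      · simp
      have h1 := hL₀ _ h
      rw [div_lt_iff₀ (by positivity)] at h1
      have h2 : ((2 : ℝ) ^ Nat.log 2 J) ≤ J := by exact_mod_cast Nat.pow_log_le_self 2 hJ.ne'
      have h3 := mul_le_mul_of_nonneg_left h2 hε.le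
      nlinarith [sq_nonneg (L₀ : ℝ)]
  unfold pos
  push_cast
  linarith

/-- Points at distance about 2^(-n) are separated by at least `wt (n + 3)`, and `pos J` is at most
J/r + K because the inserted zeros have density zero. Hence the inverse is Hölder of every exponent
below 1. -/
lemma exists_sub_le_spreadMap_sub_rpow {r : ℝ} (hr0 : 0 < r) (hr : r < 1) :
    ∃ C : ℝ, 0 ≤ C ∧ ∀ x ∈ Ico (0 : ℝ) 1, ∀ y ∈ Ico (0 : ℝ) 1, x < y →
      y - x ≤ C * (spreadMap y - spreadMap x) ^ r := by
  obtain ⟨K, hK, hpos⟩ := exists_pos_le (ε := 1 / r - 1) (by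
    rw [sub_pos, one_lt_div hr0]
    exact hr)
  refine ⟨8 * 2 ^ (r * K), by positivity, fun x hx y hy hxy => ?_⟩
  obtain ⟨n, hn1, hn2⟩ := exists_nat_pow_near_of_lt_one (sub_pos.2 hxy)
    (by linarith [hx.1, hy.2] : y - x ≤ 1) (by norm_num : (0 : ℝ) < 1 / 2)
    (by norm_num : (1 / 2 : ℝ) < 1)
  have h4 : 4 ≤ (2 : ℝ) ^ (n + 3) * (y - x) := by
    have : (2 : ℝ) ^ (n + 3) * (1 / 2) ^ (n + 1) = 4 := by
      rw [show n + 3 = (n + 1) + 2 by ring, pow_add, mul_right_comm, ← mul_pow]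
      norm_num
    rw [← this]
    gcongr
  have hw := wt_le_spreadMap_sub h4
  have hwr : (2 : ℝ) ^ (-((n : ℝ) + 3) - r * K) ≤ wt (n + 3) ^ r := by
    rw [wt, one_div, inv_pow, ← Real.rpow_natCast, ← Real.rpow_neg zero_le_two, ← Real.rpow_mul zero_le_two]
    refine Real.rpow_le_rpow_of_exponent_le one_le_two ?_
    have h := mul_le_mul_of_nonneg_left (hpos (n + 3)) hr0.le
    have e : r * ((1 + (1 / r - 1)) * ((n + 3 : ℕ) : ℝ) + K) = (n + 3) + r * K := by
      push_cast
      field_simp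
      ring
    rw [e] at h
    linarith
  calc y - x ≤ (1 / 2) ^ n := hn2
    _ = 8 * 2 ^ (r * K) * (2 : ℝ) ^ (-((n : ℝ) + 3) - r * K) := by
        rw [mul_assoc, ← Real.rpow_add two_pos, show r * K + (-((n : ℝ) + 3) - r * K) = -(n : ℝ) + (-3) by ring,
          Real.rpow_add two_pos, Real.rpow_neg zero_le_two, Real.rpow_natCast, one_div, inv_pow]
        norm_num
        ring
    _ ≤ 8 * 2 ^ (r * K) * (spreadMap y - spreadMap x) ^ r := by
        gcongr
        exact hwr.trans (Real.rpow_le_rpow (wt_pos _).le hw hr0.le)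

/-- A compact set of dimension one whose sumset with itself is null. -/
noncomputable def cantorSet : Set ℝ := closure (spreadMap '' Ico 0 1)

lemma dimH_cantorSet : dimH cantorSet = 1 := by
  refine le_antisymm ((dimH_mono (subset_univ _)).trans Real.dimH_univ.le) ?_
  refine ENNReal.le_of_forall_nnreal_lt fun r hr => ?_
  rcases eq_or_ne r 0 with rfl | hr0
  · simp
  have hr0' : 0 < r := pos_iff_ne_zero.2 hr0
  have hr1 : (r : ℝ) < 1 := by exact_mod_cast hr
  obtain ⟨C, hC, h⟩ := exists_sub_le_spreadMap_sub_rpow (r := r) (by exact_mod_cast hr0') hr1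
  have hdim : dimH (Ico (0 : ℝ) 1) = 1 := by
    rw [Real.dimH_of_nonempty_interior (by simp)]
    simp
  have hlt : ∀ x ∈ Ico (0 : ℝ) 1, ∀ y ∈ Ico (0 : ℝ) 1, x < y →
      edist x y ≤ C.toNNReal * edist (spreadMap x) (spreadMap y) ^ (r : ℝ) := by
    intro x hx y hy hxy
    have h1 := h x hx y hy hxy
    have h2 : 0 ≤ spreadMap y - spreadMap x := by
      obtain ⟨J, hJ⟩ := pow_unbounded_of_one_lt (4 / (y - x)) (one_lt_two (α := ℝ))
      refine (wt_pos J).le.trans (wt_le_spreadMap_sub ?_)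
      rw [div_lt_iff₀ (sub_pos.2 hxy)] at hJ
      exact hJ.le
    rw [edist_comm, edist_comm (spreadMap x), edist_dist, edist_dist, Real.dist_eq, Real.dist_eq,
      abs_of_pos (sub_pos.2 hxy), abs_of_nonneg h2, ENNReal.ofReal_rpow_of_nonneg h2 r.coe_nonneg,
      ← ENNReal.ofReal, ← ENNReal.ofReal_mul hC]
    exact ENNReal.ofReal_le_ofReal h1
  have hle := dimH_le_dimH_image_div_of_edist_le (g := spreadMap) (s := Ico 0 1) hr0'
    fun x hx y hy => by
      rcases lt_trichotomy x y with hxy | rfl | hxy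
      · exact hlt x hx y hy hxy
      · simp
      · rw [edist_comm, edist_comm (spreadMap x)]
        exact hlt y hy x hx hxy
  rw [hdim, ENNReal.le_div_iff_mul_le (Or.inl (by exact_mod_cast hr0)) (Or.inl ENNReal.coe_ne_top),
    one_mul] at hle
  exact hle.trans (dimH_mono subset_closure)

/-- Truncation at digit `J` gives a lattice point in [0, 1], and the remaining digits a short tail.
The finite union is closed, so it contains the closure. -/
lemma cantorSet_subset (J : ℕ) :
    cantorSet ⊆ ⋃ z ∈ Finset.range (2 ^ (pos J + 1) + 1),
      Icc ((z : ℝ) * wt J) (z * wt J + 2 * wt (J + 1)) := by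
  refine closure_minimal ?_ (isClosed_biUnion_finset fun _ _ => isClosed_Icc)
  rintro _ ⟨x, hx, rfl⟩
  obtain ⟨z, hz⟩ := exists_spread_eq J ⌊(2 : ℝ) ^ J * x⌋
  have h := spreadMap_mem_Icc x J
  have h0 := spreadMap_mem_Icc x 0
  rw [hz] at h
  have hfl : ⌊(2 : ℝ) ^ 0 * x⌋ = 0 := by
    rw [pow_zero, one_mul, Int.floor_eq_zero_iff]
    exact hx
  rw [hfl, spread_zero_right] at h0
  have hw := wt_pos J
  have h1 := two_mul_wt_succ_le 0
  rw [wt_zero] at h1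
  have hz0 : 0 ≤ z := by
    have hmono : 0 ≤ spread J ⌊(2 : ℝ) ^ J * x⌋ := by
      have hn : 0 ≤ ⌊(2 : ℝ) ^ J * x⌋ := Int.floor_nonneg.2 (mul_nonneg (by positivity) hx.1)
      obtain ⟨k, hk⟩ := Int.eq_ofNat_of_zero_le hn
      have := spread_add_mul_wt_le J 0 k
      rw [spread_zero_right, zero_add, zero_add] at this
      rw [hk]
      exact le_trans (by positivity) this
    rw [hz] at hmono
    exact_mod_cast nonneg_of_mul_nonneg_left hmono hw
  obtain ⟨k, rfl⟩ := Int.eq_ofNat_of_zero_le hz0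
  refine mem_biUnion (Finset.mem_coe.2 (Finset.mem_range.2 (Nat.lt_succ_of_le ?_))) h
  have h2 : (k : ℝ) * wt J ≤ 1 := by
    have := h.1
    push_cast at this
    linarith [h0.2]
  have h3 : (k : ℝ) ≤ 2 ^ pos J := by
    rw [wt, one_div, inv_pow, ← div_eq_mul_inv, div_le_one (by positivity)] at h2
    exact h2
  have h4 : k ≤ 2 ^ pos J := by exact_mod_cast h3
  exact h4.trans (Nat.pow_le_pow_right two_pos (Nat.le_succ _))

lemma isCompact_cantorSet : IsCompact cantorSet := by
  refine Metric.isCompact_of_isClosed_isBounded isClosed_closure ?_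
  exact ((Bornology.isBounded_biUnion_finset _).2 fun _ _ => Metric.isBounded_Icc _ _).subset
    (cantorSet_subset 0)

/-- Sums of left endpoints stay in the lattice, so the number of intervals remains of order `2 ^ pos
J` instead of being squared; only the lengths double. The constant is 28 = 4 · (4 + 3). -/
lemma volume_cantorSet_add_le (J : ℕ) :
    volume (cantorSet + cantorSet) ≤ ENNReal.ofReal (28 * (2 ^ pos J * wt (J + 1))) := by
  have hsub : cantorSet + cantorSet ⊆ ⋃ z ∈ Finset.range (2 ^ (pos J + 2) + 3),
      Icc ((z : ℝ) * wt J) (z * wt J + 4 * wt (J + 1)) := by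
    rintro _ ⟨x, hx, y, hy, rfl⟩
    obtain ⟨z, hz, hxz⟩ := mem_iUnion₂.1 (cantorSet_subset J hx)
    obtain ⟨w, hw, hyw⟩ := mem_iUnion₂.1 (cantorSet_subset J hy)
    rw [Finset.mem_range] at hz hw
    refine mem_biUnion (x := z + w) (Finset.mem_coe.2 (Finset.mem_range.2 ?_)) ?_
    · rw [pow_succ] at hz hw ⊢
      rw [pow_succ]
      omega
    · push_cast
      constructor <;> linarith [hxz.1, hxz.2, hyw.1, hyw.2]
  have hw := wt_pos (J + 1)
  calc volume (cantorSet + cantorSet)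
      ≤ ∑ z ∈ Finset.range (2 ^ (pos J + 2) + 3),
          volume (Icc ((z : ℝ) * wt J) (z * wt J + 4 * wt (J + 1))) :=
        (measure_mono hsub).trans (measure_biUnion_finset_le _ _)
    _ = ENNReal.ofReal ((2 ^ (pos J + 2) + 3) * (4 * wt (J + 1))) := by
        simp only [Real.volume_Icc, add_sub_cancel_left, Finset.sum_const, Finset.card_range,
          nsmul_eq_mul]
        rw [← ENNReal.ofReal_natCast, ← ENNReal.ofReal_mul (by positivity)]
        push_cast
        rfl
    _ ≤ _ := by
        apply ENNReal.ofReal_le_ofReal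
        have : (1 : ℝ) ≤ 2 ^ pos J := one_le_pow₀ one_le_two
        rw [pow_add]
        nlinarith

lemma volume_cantorSet_add : volume (cantorSet + cantorSet) = 0 := by
  have hle : ∀ k : ℕ, volume (cantorSet + cantorSet) ≤ ENNReal.ofReal (28 * (1 / 2) ^ k) := by
    intro k
    -- At this index the logarithm jumps from k to k + 1, so a block of 2k + 1 zeros follows and the
    -- intervals become far shorter than their spacing.
    refine (volume_cantorSet_add_le (2 ^ (k + 1) - 1)).trans (ENNReal.ofReal_le_ofReal ?_)
    have h1 : 2 ^ (k + 1) - 1 + 1 = 2 ^ (k + 1) := Nat.sub_add_cancel Nat.one_le_two_pow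
    have h2 : Nat.log 2 (2 ^ (k + 1) - 1) < k + 1 :=
      Nat.log_lt_of_lt_pow' (by omega) (by omega)
    have hpos : pos (2 ^ (k + 1) - 1) + k ≤ pos (2 ^ (k + 1)) := by
      unfold pos
      rw [Nat.log_pow one_lt_two]
      have : Nat.log 2 (2 ^ (k + 1) - 1) ^ 2 ≤ k ^ 2 := Nat.pow_le_pow_left (by omega) 2
      nlinarith
    rw [h1]
    gcongr
    calc (2 : ℝ) ^ pos (2 ^ (k + 1) - 1) * wt (2 ^ (k + 1))
        ≤ 2 ^ pos (2 ^ (k + 1) - 1) * (1 / 2) ^ (pos (2 ^ (k + 1) - 1) + k) := by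
          gcongr
          exact pow_le_pow_of_le_one (by norm_num) (by norm_num) hpos
      _ = (1 / 2) ^ k := by
          rw [pow_add _ (pos _) k, ← mul_assoc, ← mul_pow]
          norm_num
  have hlim : Tendsto (fun k : ℕ => ENNReal.ofReal (28 * (1 / 2) ^ k)) atTop (𝓝 0) := by
    have := (tendsto_pow_atTop_nhds_zero_of_lt_one (by norm_num : (0 : ℝ) ≤ 1 / 2)
      (by norm_num)).const_mul 28
    rw [mul_zero] at this
    simpa using ENNReal.tendsto_ofReal this
  exact le_antisymm (ge_of_tendsto' hlim hle) bot_le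

lemma cantorSet_nonempty : cantorSet.Nonempty :=
  ((nonempty_Ico.2 zero_lt_one).image spreadMap).closure

end SparseCantor

theorem corollary1p5 :
    (∀ A B C : Set ℝ, MeasurableSet A → MeasurableSet B → MeasurableSet C →
      2 < dimH A + dimH B + dimH C → 0 < volume (A * (B + C))) ∧
    (∃ A B C : Set ℝ, IsCompact A ∧ IsCompact B ∧ IsCompact C ∧
      A.Nonempty ∧ B.Nonempty ∧ C.Nonempty ∧
      dimH A + dimH B + dimH C = 2 ∧ volume (A * (B + C)) = 0) := by
  refine ⟨fun A B C hA hB hC h => volume_mul_add_pos hA hB hC h, {1}, SparseCantor.cantorSet,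
    SparseCantor.cantorSet, isCompact_singleton, SparseCantor.isCompact_cantorSet,
    SparseCantor.isCompact_cantorSet, singleton_nonempty 1, SparseCantor.cantorSet_nonempty,
    SparseCantor.cantorSet_nonempty, ?_, ?_⟩
  · rw [dimH_singleton, SparseCantor.dimH_cantorSet, zero_add, one_add_one_eq_two]
  · rw [show ({1} : Set ℝ) = 1 from rfl, one_mul]
    exact SparseCantor.volume_cantorSet_add
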